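/- Let $\mathcal H$ be a separable real Hilbert space, let $\mu=\bigotimes_{m\ge1}N(0,1)$ be the countable product of standard Gaussian measures on $\mathbb R^{\mathbb N}$, and write $\|\cdot\|_{L^2_\mu}$ for the norm of $L^2_\mu(\mathbb R^{\mathbb N};\mathcal H)$. Let $\mathcal F$ be the set of finitely supported $\nu\in\mathbb N_0^{\mathbb N}$, ordered componentwise. A set $\Lambda\subset\mathcal F$ is called monotone if $\nu\in\Lambda$ and $\tilde\nu\le\nu$ imply $\tilde\nu\in\Lambda$. Let $H_n$ be the univariate Hermite polynomial of degree $n$, orthonormal with respect to $N(0,1)$, and $H_\nu(\xi)=\prod_m H_{\nu_m}(\xi_m)$ for $\nu\in\mathcal F$. For each $k\in\mathbb N_0$ let $\Xi^{(k)}=\{\xi^{(k)}_0,\dots,\xi^{(k)}_k\}\subset\mathbb R$ be a set of $k+1$ distinct nodes, let $L^{(k)}_0,\dots,L^{(k)}_k$ be the associated Lagrange fundamental polynomials, $U_kg=\sum_{i=0}^k g(\xi^{(k)}_i)L^{(k)}_i$ the interpolation operator, and $\Delta_k=U_k-U_{k-1}$ with $U_{-1}=0$. For $\mathbf k\in\mathcal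 F$ let $\Xi^{(\mathbf k)}=\prod_m\Xi^{(k_m)}$, let $U_{\mathbf k}=\bigotimes_m U_{k_m}$ be the tensor product interpolation operator, which uses the point values at $\Xi^{(\mathbf k)}$, and let $\Delta_{\mathbf k}=\bigotimes_m\Delta_{k_m}$. For finite $\Lambda\subset\mathcal F$ put $U_\Lambda=\sum_{\mathbf k\in\Lambda}\Delta_{\mathbf k}$. Assume that there are $\theta\ge0$ and $K\ge1$ such that, with the norm of $L^2(\mathbb R,N(0,1))$ on the left, $$\|\Delta_iH_\nu\|_{L^2_\mu}\le(1+K\nu)^\theta\qquad\text{for all } i,\nu\in\mathbb N_0 .$$ Let $\Gamma\subset\mathbb R^{\mathbb N}$ with $\mu(\Gamma)=1$ and $\Xi^{(\mathbf k)}\subset\Gamma$ for all $\mathbf k\in\mathcal F$. Let $f:\Gamma\to\mathcal H$ have a measurable extension to $\mathbb R^{\mathbb N}$, again denoted by $f$, in $L^2_\mu(\mathbb R^{\mathbb N};\mathcal H)$, and let $f_\nu=\int fH_\nu\,d\mu$ be its Hermite coefficients. Assume that the point values of $f$ at the nodes are those of its Hermite expansion: whenever $\xi\in\bigcup_{\mathbf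 k\in\mathcal F}\Xi^{(\mathbf k)}$ and the series $\sum_{\nu\in\mathcal F}f_\nu H_\nu(\xi)$ converges unconditionally in $\mathcal H$, its sum is $f(\xi)$. Let $p\in(0,2)$, let $r\in\mathbb N_0$ satisfy $r>2(\theta+1)+\frac2p$, and suppose that there are $\tau_m>0$ with $(\tau_m^{-1})_m\in\ell^p(\mathbb N)$ such that for all $\alpha\in\mathcal F$ with $|\alpha|_\infty\le r$ the weak partial derivative $\partial^\alpha f$ exists in $L^2_\mu(\mathbb R^{\mathbb N};\mathcal H)$, and $$\sum_{|\alpha|_\infty\le r}\frac{\tau^{2\alpha}}{\alpha!}\,\|\partial^\alpha f\|_{L^2_\mu}^2<\infty,\qquad \tau^{2\alpha}=\prod_m\tau_m^{2\alpha_m},\quad \alpha!=\prod_m\alpha_m! .$$ Then there are a nested sequence of monotone finite sets $\Lambda_N\subset\mathcal F$ with $|\Lambda_N|=N$, $N\in\mathbb N_0$, and a constant $C$ independent of $N$, such that $$\|f-U_{\Lambda_N}f\|_{L^2_\mu}\le C(1+N)^{-\left(\frac1p-\frac12\right)}\qquad\text{for all }N\in\mathbb N_0 .$$ -/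

import Mathlib

open MeasureTheory ProbabilityTheory
open scoped ContDiff ENNReal

noncomputable section

namespace SparseCollocation

/-- The countable product of standard Gaussian measures on `ℝ^ℕ`. -/
def gaussMeasure : Measure (ℕ → ℝ) :=
  Measure.infinitePi (fun _ : ℕ => gaussianReal 0 1)

/-- The univariate Hermite polynomial of degree `n`, orthonormal for `N(0,1)`. -/
def hermiteFun (n : ℕ) (t : ℝ) : ℝ :=
  Polynomial.aeval t (Polynomial.hermite n) / √(n.factorial : ℝ)

/-- The tensor product Hermite polynomial `H_ν(ξ) = ∏ₘ H_{νₘ}(ξₘ)`; the factors with `νₘ = 0`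
equal `1`. Finitely supported multi-indices are elements of `ℕ →₀ ℕ`. -/
def hermiteMulti (ν : ℕ →₀ ℕ) (ξ : ℕ → ℝ) : ℝ :=
  ν.prod fun m n => hermiteFun n (ξ m)

/-! ### Univariate interpolation

A family of nodes is `x : ℕ → ℕ → ℝ`; the nodes of level `k` are `x k 0, …, x k k`
(the values `x k i` with `i > k` are never used). -/

/-- The Lagrange fundamental polynomial `L_i^{(k)}`, for `i ≤ k`. -/
def lagrangeFun (x : ℕ → ℕ → ℝ) (k i : ℕ) (t : ℝ) : ℝ :=
  (Lagrange.basis (Finset.range (k + 1)) (x k) i).eval t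

/-- The univariate interpolation operator `U_k`. -/
def interp (x : ℕ → ℕ → ℝ) (k : ℕ) (g : ℝ → ℝ) (t : ℝ) : ℝ :=
  ∑ i ∈ Finset.range (k + 1), g (x k i) * lagrangeFun x k i t

/-- The univariate detail operator `Δ_k = U_k - U_{k-1}`, where `U_{-1} = 0`. -/
def detail (x : ℕ → ℕ → ℝ) : ℕ → (ℝ → ℝ) → ℝ → ℝ
  | 0, g, t => interp x 0 g t
  | k + 1, g, t => interp x (k + 1) g t - interp x k g t

/-! ### Tensorized operators -/

/-- The Cartesian product `Ξ^{(k)}` of the node sets of levels `k₀, k₁, …`. -/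
def nodeGrid (x : ℕ → ℕ → ℝ) (k : ℕ →₀ ℕ) : Set (ℕ → ℝ) :=
  {ξ | ∀ m, ∃ i ≤ k m, ξ m = x (k m) i}

/-- The node `ξ_i^{(k)}`. -/
def gridNode (x : ℕ → ℕ → ℝ) (k i : ℕ →₀ ℕ) : ℕ → ℝ := fun m => x (k m) (i m)

theorem gridNode_mem (x : ℕ → ℕ → ℝ) {k i : ℕ →₀ ℕ} (h : i ≤ k) :
    gridNode x k i ∈ nodeGrid x k := fun m => ⟨i m, h m, rfl⟩

/-- `L_i^{(k)}(ξ) = ∏ₘ L_{iₘ}^{(kₘ)}(ξₘ)`, for `i ≤ k`; the factors with `kₘ = 0` equal `1`. -/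
def lagrangeMulti (x : ℕ → ℕ → ℝ) (k i : ℕ →₀ ℕ) (ξ : ℕ → ℝ) : ℝ :=
  ∏ m ∈ k.support, lagrangeFun x (k m) (i m) (ξ m)

variable {H : Type*} [NormedAddCommGroup H] [InnerProductSpace ℝ H]

/-- The full tensor product interpolation operator `U_k`, acting on functions on `Γ`. -/
def tensorInterp (x : ℕ → ℕ → ℝ) {Γ : Set (ℕ → ℝ)} (hΓ : ∀ k, nodeGrid x k ⊆ Γ)
    (k : ℕ →₀ ℕ) (f : Γ → H) (ξ : ℕ → ℝ) : H :=
  ∑ i : {i : ℕ →₀ ℕ // i ∈ Finset.Icc 0 k},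
    lagrangeMulti x k i ξ •
      f ⟨gridNode x k i, hΓ k (gridNode_mem x (Finset.mem_Icc.1 i.2).2)⟩

/-- The tensorized detail operator `Δ_k = ⨂ₘ (U_{kₘ} - U_{kₘ-1})`, multiplied out: `S` is the set
of coordinates in which `-U_{kₘ-1}` is chosen. Since `U_{-1} = 0`, only sets of coordinates with
`kₘ > 0` contribute. -/
def tensorDetail (x : ℕ → ℕ → ℝ) {Γ : Set (ℕ → ℝ)} (hΓ : ∀ k, nodeGrid x k ⊆ Γ)
    (k : ℕ →₀ ℕ) (f : Γ → H) (ξ : ℕ → ℝ) : H :=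
  ∑ S ∈ k.support.powerset,
    (-1 : ℝ) ^ S.card • tensorInterp x hΓ (k - ∑ m ∈ S, Finsupp.single m 1) f ξ

/-- The sparse collocation operator `U_Λ = ∑_{k ∈ Λ} Δ_k`. -/
def sparseCollocation (x : ℕ → ℕ → ℝ) {Γ : Set (ℕ → ℝ)} (hΓ : ∀ k, nodeGrid x k ⊆ Γ)
    (Λ : Finset (ℕ →₀ ℕ)) (f : Γ → H) (ξ : ℕ → ℝ) : H :=
  ∑ k ∈ Λ, tensorDetail x hΓ k f ξ

/-! ### Hermite coefficients and weak derivatives -/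

/-- The Hermite coefficient `F_ν = ∫ F H_ν dμ`. -/
def hermiteCoeff (F : (ℕ → ℝ) → H) (ν : ℕ →₀ ℕ) : H :=
  ∫ ξ, hermiteMulti ν ξ • F ξ ∂gaussMeasure

/-- Test functions: smooth compactly supported functions of finitely many coordinates. -/
def IsTestFunction (φ : (ℕ → ℝ) → ℝ) : Prop :=
  ∃ (n : ℕ) (ψ : (Fin n → ℝ) → ℝ), ContDiff ℝ ∞ ψ ∧ HasCompactSupport ψ ∧
    φ = fun ξ => ψ fun j => ξ j

/-- The partial derivative in the `m`-th coordinate of a (smooth cylindrical) function. -/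
def partialDeriv (m : ℕ) (φ : (ℕ → ℝ) → ℝ) (ξ : ℕ → ℝ) : ℝ :=
  deriv (fun t => φ (Function.update ξ m t)) (ξ m)

/-- `h` is the weak partial derivative of `g` in the `m`-th coordinate: integration by parts
against the Gaussian measure, `∫ h φ dμ = ∫ g (ξₘ φ - ∂ₘ φ) dμ` for all test functions `φ`.
It is used for `g` and `h` in `L²` only. -/
def IsWeakPartial (m : ℕ) (g h : (ℕ → ℝ) → H) : Prop :=
  ∀ φ : (ℕ → ℝ) → ℝ, IsTestFunction φ →
    ∫ ξ, φ ξ • h ξ ∂gaussMeasure =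
      ∫ ξ, (ξ m * φ ξ - partialDeriv m φ ξ) • g ξ ∂gaussMeasure

/-- The weighted smoothness condition on `F`: the functions `D α` are the weak derivatives
`∂^α F`, `|α|_∞ ≤ r`. As the set of these `α` is closed under passing to smaller multi-indices,
they are described by `D 0 = F` and `∂ₘ (D α) = D (α + eₘ)`. -/
def WeightedSmooth (p : ℝ) (r : ℕ) (F : (ℕ → ℝ) → H) : Prop :=
  ∃ τ : ℕ → ℝ, (∀ m, 0 < τ m) ∧ (Summable fun m => ((τ m)⁻¹) ^ p) ∧
    ∃ D : (ℕ →₀ ℕ) → (ℕ → ℝ) → H,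
      D 0 =ᵐ[gaussMeasure] F ∧
      (∀ α : ℕ →₀ ℕ, (∀ j, α j ≤ r) → MemLp (D α) 2 gaussMeasure) ∧
      (∀ (α : ℕ →₀ ℕ) (m : ℕ), (∀ j, (α + Finsupp.single m 1 : ℕ →₀ ℕ) j ≤ r) →
        IsWeakPartial m (D α) (D (α + Finsupp.single m 1))) ∧
      Summable fun α : {α : ℕ →₀ ℕ // ∀ j, α j ≤ r} =>
        (α.1.prod fun m k => τ m ^ (2 * k)) / (α.1.prod fun _ k => (k.factorial : ℝ)) *
          (eLpNorm (D α.1) 2 gaussMeasure).toReal ^ 2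

end SparseCollocation

end

noncomputable section

/-! Write `F` as its Hermite series and let `U_Λ` act on each term. If `Λ` is monotone, `U_Λ`
reproduces `H_ν` for every `ν ∈ Λ`: a detail `Δ_k H_ν` vanishes unless `k ≤ ν`, and the details with
`k ≤ ν` telescope to `H_ν`. In general `H_ν - U_Λ H_ν` is the sum of those `Δ_k H_ν` with `k ≤ ν`
and `k ∉ Λ`. There are at most `∏ (1 + ν_m)` of them, each of norm at most `∏ (1 + K ν_m)^θ`, so its
norm is at most `c_ν = ∏ (1 + K ν_m)^(θ+1)` (`eLpNorm_hermiteMulti_sub_sparseCollocation_le`). Hence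
the error for `f` is at most the sum of `c_ν ‖f_ν‖` over `ν ∉ Λ`
(`norm_toLp_sub_toLp_sparseCollocation_le`).

To split `f` at the nodes, the Hermite series must converge there. On polynomials of degree at most
`k`, point evaluation is bounded by the `L²` norm, so the bound on the details also controls `H_ν`
at the nodes (`exists_abs_hermiteMulti_node_le`). Convergence to `F` in `L²` rests on completeness
of the Hermite system, proved by a Fourier argument (`ae_eq_zero_of_integral_hermiteMulti_mul`).

Smoothness enters through `ν! ‖(∂^α F)_ν‖² = (ν+α)! ‖F_(ν+α)‖²`. Choosing a single `α ≤ ν` for each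
`ν` and applying Bessel to every `∂^α F` gives `∑ b_ν ‖f_ν‖² < ∞` with `b_ν = ∏ (ν_m choose α_m)
τ_m^(2α_m)` (`summable_hermiteWeight_mul`). The condition on `r` yields `c_ν ≤ A g_ν √b_ν` with `g`
strictly decreasing and in `ℓ^p` (`exists_decay_majorant`). Let `Λ_N` collect `N` largest values of
`g`; strict decrease makes it monotone, and Stechkin's estimate bounds the `ℓ²` tail of `g`
(`exists_nested_sets`). Cauchy–Schwarz then gives the rate. -/

namespace SparseCollocation

/-! ### Univariate Hermite polynomials: recurrences and orthonormality -/

open Polynomial in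
theorem derivative_hermite_succ (n : ℕ) :
    derivative (hermite (n + 1)) = (n + 1 : ℤ[X]) * hermite n := by
  induction n with
  | zero => simp
  | succ n ih =>
    rw [hermite_succ (n + 1), derivative_sub, derivative_mul, ih, derivative_mul, derivative_X,
      derivative_add, derivative_natCast, derivative_one, hermite_succ n]
    push_cast
    ring

theorem hermiteFun_zero (t : ℝ) : hermiteFun 0 t = 1 := by simp [hermiteFun]

theorem sqrt_factorial_succ (n : ℕ) :
    √((n + 1).factorial : ℝ) = √(n + 1 : ℝ) * √(n.factorial : ℝ) := by
  rw [Nat.factorial_succ, Nat.cast_mul, Real.sqrt_mul (by positivity)]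
  push_cast
  rfl

theorem sqrt_factorial_pos (n : ℕ) : 0 < √(n.factorial : ℝ) :=
  Real.sqrt_pos.2 (by exact_mod_cast n.factorial_pos)

/-- For `n = 0` the truncated index `n - 1` is harmless, because its coefficient is `√0`. The same
convention is used in the recurrences below. -/
theorem hasDerivAt_hermiteFun (n : ℕ) (t : ℝ) :
    HasDerivAt (hermiteFun n) (√(n : ℝ) * hermiteFun (n - 1) t) t := by
  have h := ((Polynomial.hermite n).hasDerivAt_aeval t).div_const √(n.factorial : ℝ)
  refine h.congr_deriv ?_
  cases n with
  | zero => simp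
  | succ n =>
    rw [derivative_hermite_succ, sqrt_factorial_succ]
    have h1 := sqrt_factorial_pos n
    have h2 : 0 < √(n + 1 : ℝ) := by positivity
    have h3 : √(n + 1 : ℝ) ^ 2 = n + 1 := Real.sq_sqrt (by positivity)
    simp only [hermiteFun, map_mul, map_add, map_natCast, map_one, Nat.add_sub_cancel]
    push_cast
    field_simp
    rw [h3, mul_comm]

theorem deriv_hermiteFun (n : ℕ) (t : ℝ) :
    deriv (hermiteFun n) t = √(n : ℝ) * hermiteFun (n - 1) t :=
  (hasDerivAt_hermiteFun n t).deriv

theorem mul_hermiteFun_sub_deriv (n : ℕ) (t : ℝ) :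
    t * hermiteFun n t - √(n : ℝ) * hermiteFun (n - 1) t = √(n + 1 : ℝ) * hermiteFun (n + 1) t := by
  have h := ((Polynomial.hermite n).hasDerivAt_aeval t).div_const √(n.factorial : ℝ)
  rw [← (h.unique (hasDerivAt_hermiteFun n t))]
  have h1 := sqrt_factorial_pos n
  have h2 : 0 < √(n + 1 : ℝ) := by positivity
  simp only [hermiteFun, sqrt_factorial_succ, Polynomial.hermite_succ, map_sub, map_mul,
    Polynomial.aeval_X]
  field_simp

theorem mul_hermiteFun (n : ℕ) (t : ℝ) :
    t * hermiteFun n t =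
      √(n + 1 : ℝ) * hermiteFun (n + 1) t + √(n : ℝ) * hermiteFun (n - 1) t := by
  rw [← mul_hermiteFun_sub_deriv]
  ring

theorem contDiff_hermiteFun (n : ℕ) : ContDiff ℝ ∞ (hermiteFun n) := by
  unfold hermiteFun
  exact ((Polynomial.hermite n).contDiff_aeval _).div_const _

theorem continuous_hermiteFun (n : ℕ) : Continuous (hermiteFun n) :=
  (contDiff_hermiteFun n).continuous

/-- The orthonormal Hermite polynomial as an element of `ℝ[X]`. -/
def hermitePoly (n : ℕ) : Polynomial ℝ :=
  Polynomial.C (√(n.factorial : ℝ))⁻¹ * (Polynomial.hermite n).map (Int.castRingHom ℝ)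

theorem eval_hermitePoly (n : ℕ) (t : ℝ) : (hermitePoly n).eval t = hermiteFun n t := by
  simp [hermitePoly, hermiteFun, Polynomial.eval_map, Polynomial.aeval_def, div_eq_inv_mul]

theorem degree_hermitePoly_le (n : ℕ) : (hermitePoly n).degree ≤ n := by
  unfold hermitePoly
  rw [Polynomial.degree_C_mul (inv_ne_zero (sqrt_factorial_pos n).ne')]
  exact Polynomial.degree_map_le.trans (Polynomial.degree_hermite n).le

theorem memLp_polynomial (q : Polynomial ℝ) :
    MemLp (fun t => q.eval t) 2 (gaussianReal 0 1) := by
  induction q using Polynomial.induction_on' with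
  | add p q hp hq =>
    simp only [Polynomial.eval_add]
    exact hp.add hq
  | monomial n a =>
    simp only [Polynomial.eval_monomial]
    refine MemLp.const_mul ?_ a
    rw [memLp_two_iff_integrable_sq (by fun_prop)]
    have h := (memLp_id_gaussianReal (μ := 0) (v := 1) ((2 * n : ℕ) : NNReal))
    have h2 := MemLp.integrable_norm_pow' (p := 2 * n) (f := (id : ℝ → ℝ))
      (μ := gaussianReal 0 1) (by exact_mod_cast h)
    refine h2.congr (ae_of_all _ fun t => ?_)
    simp only [id, Real.norm_eq_abs]
    rw [pow_mul, sq_abs, ← pow_mul, ← pow_mul, mul_comm]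

theorem memLp_hermiteFun (n : ℕ) : MemLp (hermiteFun n) 2 (gaussianReal 0 1) := by
  simpa only [eval_hermitePoly] using memLp_polynomial (hermitePoly n)

theorem integrable_polynomial (q : Polynomial ℝ) :
    Integrable (fun t => q.eval t) (gaussianReal 0 1) :=
  (memLp_polynomial q).integrable one_le_two

theorem integrable_gaussianPDF_mul_polynomial (q : Polynomial ℝ) :
    Integrable (fun t => gaussianPDFReal 0 1 t * q.eval t) := by
  have h := integrable_polynomial q
  rw [gaussianReal_of_var_ne_zero _ one_ne_zero,
    integrable_withDensity_iff_integrable_smul₀' (measurable_gaussianPDF _ _).aemeasurable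
      (ae_of_all _ fun _ => gaussianPDF_lt_top)] at h
  refine h.congr (ae_of_all _ fun t => ?_)
  simp [gaussianPDF, gaussianPDFReal_nonneg]

/-- Against the Gaussian density the integrand is the derivative of `-q` times the density, and both
functions are integrable on the line. -/
theorem integral_mul_sub_derivative_eq_zero (q : Polynomial ℝ) :
    ∫ t, (t * q.eval t - q.derivative.eval t) ∂(gaussianReal 0 1) = 0 := by
  rw [integral_gaussianReal_eq_integral_smul one_ne_zero]
  have hd : ∀ t : ℝ, HasDerivAt (fun t => gaussianPDFReal 0 1 t * (-q).eval t)
      (gaussianPDFReal 0 1 t • (t * q.eval t - q.derivative.eval t)) t := by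
    intro t
    have h1 : HasDerivAt (gaussianPDFReal 0 1) (gaussianPDFReal 0 1 t * (-t)) t := by
      have h3 : HasDerivAt (fun t : ℝ => -(t - 0) ^ 2 / (2 * ((1 : NNReal) : ℝ))) (-t) t := by
        have := (((hasDerivAt_id t).sub_const 0).pow 2).neg.div_const (2 * ((1 : NNReal) : ℝ))
        refine this.congr_deriv ?_
        simp
        ring
      rw [gaussianPDFReal_def]
      refine (h3.exp.const_mul _).congr_deriv ?_
      ring
    refine (h1.mul ((-q).hasDerivAt t)).congr_deriv ?_
    simp
    ring
  refine integral_eq_zero_of_hasDerivAt_of_integrable hd ?_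
    (integrable_gaussianPDF_mul_polynomial _)
  refine (integrable_gaussianPDF_mul_polynomial
    (Polynomial.X * q - Polynomial.derivative q)).congr (ae_of_all _ fun t => ?_)
  simp

theorem integral_hermiteFun_succ_mul (n : ℕ) (q : Polynomial ℝ) :
    √(n + 1 : ℝ) * ∫ t, hermiteFun (n + 1) t * q.eval t ∂(gaussianReal 0 1) =
      ∫ t, hermiteFun n t * q.derivative.eval t ∂(gaussianReal 0 1) := by
  have h := integral_mul_sub_derivative_eq_zero (hermitePoly n * q)
  have hder : ∀ t : ℝ, (hermitePoly n).derivative.eval t = √(n : ℝ) * hermiteFun (n - 1) t := by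
    intro t
    refine ((hermitePoly n).hasDerivAt t).unique ?_
    simpa only [eval_hermitePoly] using hasDerivAt_hermiteFun n t
  have hpt : ∀ t : ℝ, t * (hermitePoly n * q).eval t - (hermitePoly n * q).derivative.eval t =
      √(n + 1 : ℝ) * (hermiteFun (n + 1) t * q.eval t) -
        hermiteFun n t * q.derivative.eval t := by
    intro t
    rw [Polynomial.derivative_mul, Polynomial.eval_add, Polynomial.eval_mul, Polynomial.eval_mul,
      Polynomial.eval_mul, hder, eval_hermitePoly, ← mul_assoc, ← mul_assoc,
      ← mul_hermiteFun_sub_deriv]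
    ring
  simp only [hpt] at h
  have i1 := integrable_polynomial (hermitePoly (n + 1) * q)
  have i2 := integrable_polynomial (hermitePoly n * q.derivative)
  simp only [Polynomial.eval_mul, eval_hermitePoly] at i1 i2
  rw [integral_sub (i1.const_mul _) i2, integral_const_mul] at h
  linarith

/-- Raising is adjoint to differentiation, so the inner product of degrees `n + 1` and `m` reduces
to that of `n` and `m - 1`. The induction stops when one degree is zero, where the factor `√0` gives
orthogonality. -/
theorem integral_hermiteFun_mul (n m : ℕ) :
    ∫ t, hermiteFun n t * hermiteFun m t ∂(gaussianReal 0 1) = if n = m then 1 else 0 := by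
  have key : ∀ n m : ℕ, √(n + 1 : ℝ) * ∫ t, hermiteFun (n + 1) t * hermiteFun m t
      ∂(gaussianReal 0 1) = √(m : ℝ) * ∫ t, hermiteFun n t * hermiteFun (m - 1) t
      ∂(gaussianReal 0 1) := by
    intro n m
    have h := integral_hermiteFun_succ_mul n (hermitePoly m)
    have hder : ∀ t : ℝ, (hermitePoly m).derivative.eval t = √(m : ℝ) * hermiteFun (m - 1) t := by
      intro t
      refine ((hermitePoly m).hasDerivAt t).unique ?_
      simpa only [eval_hermitePoly] using hasDerivAt_hermiteFun m t
    simp only [eval_hermitePoly, hder] at h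
    rw [h, ← integral_const_mul]
    congr 1 with t
    ring
  have hpos : ∀ n : ℕ, √(n + 1 : ℝ) ≠ 0 := fun n => by positivity
  induction n generalizing m with
  | zero =>
    cases m with
    | zero => simp [hermiteFun_zero]
    | succ m =>
      have h := key m 0
      simp only [Nat.cast_zero, Real.sqrt_zero, zero_mul, mul_eq_zero, hpos, false_or] at h
      simpa [mul_comm] using h
  | succ n ih =>
    cases m with
    | zero =>
      have h := key n 0
      simp only [Nat.cast_zero, Real.sqrt_zero, zero_mul, mul_eq_zero, hpos, false_or] at h
      simpa using h
    | succ m =>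
      have h := key n (m + 1)
      have h1 := key m (n + 1)
      rw [Nat.add_sub_cancel, ih] at h
      push_cast at h
      by_cases hnm : n = m
      · subst hnm
        simpa using mul_left_cancel₀ (hpos n) h
      · simpa [hnm, hpos] using h

/-! ### Products of univariate functions -/

instance : IsProbabilityMeasure gaussMeasure := by
  unfold gaussMeasure
  infer_instance

theorem lintegral_prod_gaussMeasure (s : Finset ℕ) (g : ℕ → ℝ → ℝ≥0∞)
    (hg : ∀ m, Measurable (g m)) :
    ∫⁻ ξ, ∏ m ∈ s, g m (ξ m) ∂gaussMeasure = ∏ m ∈ s, ∫⁻ t, g m t ∂(gaussianReal 0 1) := by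
  have hind : iIndepFun (fun (m : ℕ) (ξ : ℕ → ℝ) => g m (ξ m)) gaussMeasure :=
    iIndepFun_infinitePi (P := fun _ => gaussianReal 0 1) hg
  rw [lintegral_prod_eq_prod_lintegral_of_indepFun s _ hind fun m => by fun_prop]
  refine Finset.prod_congr rfl fun m _ => ?_
  exact (measurePreserving_eval_infinitePi (fun _ : ℕ => gaussianReal 0 1) m).lintegral_comp (hg m)

theorem integral_prod_gaussMeasure (s : Finset ℕ) (g : ℕ → ℝ → ℝ) (hg : ∀ m, Measurable (g m)) :
    ∫ ξ, ∏ m ∈ s, g m (ξ m) ∂gaussMeasure = ∏ m ∈ s, ∫ t, g m t ∂(gaussianReal 0 1) := by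
  have hind : iIndepFun (fun (m : ℕ) (ξ : ℕ → ℝ) => g m (ξ m)) gaussMeasure :=
    iIndepFun_infinitePi (P := fun _ => gaussianReal 0 1) hg
  have hind' : iIndepFun (fun (m : s) (ξ : ℕ → ℝ) => g m (ξ m)) gaussMeasure :=
    hind.precomp Subtype.val_injective
  have h := hind'.integral_fun_prod_eq_prod_integral fun m =>
    (by fun_prop : Measurable fun ξ : ℕ → ℝ => g m (ξ m)).aestronglyMeasurable
  rw [Finset.prod_coe_sort s fun m => ∫ ξ, g m (ξ m) ∂gaussMeasure] at h
  have h2 : ∀ ξ : ℕ → ℝ, ∏ m : s, g m (ξ m) = ∏ m ∈ s, g m (ξ m) := fun ξ =>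
    Finset.prod_coe_sort s fun m => g m (ξ m)
  simp only [h2] at h
  rw [h]
  refine Finset.prod_congr rfl fun m _ => ?_
  have hm := (measurePreserving_eval_infinitePi (fun _ : ℕ => gaussianReal 0 1) m)
  rw [← hm.map_eq, integral_map hm.aemeasurable (hg m).aestronglyMeasurable]
  rfl

theorem eLpNorm_prod_gaussMeasure (s : Finset ℕ) (g : ℕ → ℝ → ℝ) (hg : ∀ m, Measurable (g m)) :
    eLpNorm (fun ξ : ℕ → ℝ => ∏ m ∈ s, g m (ξ m)) 2 gaussMeasure =
      ∏ m ∈ s, eLpNorm (g m) 2 (gaussianReal 0 1) := by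
  simp only [eLpNorm_eq_lintegral_rpow_enorm_toReal two_ne_zero ENNReal.ofNat_ne_top]
  rw [ENNReal.prod_rpow_of_nonneg (by positivity), ← lintegral_prod_gaussMeasure s
    (fun m t => ‖g m t‖ₑ ^ (2 : ℝ≥0∞).toReal) (fun m => by fun_prop)]
  congr 2 with ξ
  rw [ENNReal.prod_rpow_of_nonneg (by positivity)]
  congr 1
  simp only [enorm_eq_nnnorm, nnnorm_prod, ENNReal.ofNNReal_finsetProd]

theorem memLp_prod_gaussMeasure (s : Finset ℕ) (g : ℕ → ℝ → ℝ) (hg : ∀ m, Measurable (g m))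
    (hg2 : ∀ m ∈ s, MemLp (g m) 2 (gaussianReal 0 1)) :
    MemLp (fun ξ : ℕ → ℝ => ∏ m ∈ s, g m (ξ m)) 2 gaussMeasure := by
  refine ⟨(by fun_prop : Measurable fun ξ : ℕ → ℝ => ∏ m ∈ s, g m (ξ m)).aestronglyMeasurable, ?_⟩
  rw [eLpNorm_prod_gaussMeasure s g hg]
  exact ENNReal.prod_lt_top fun m hm => (hg2 m hm).2

theorem hermiteMulti_eq_prod {ν : ℕ →₀ ℕ} {s : Finset ℕ} (h : ν.support ⊆ s) (ξ : ℕ → ℝ) :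
    hermiteMulti ν ξ = ∏ m ∈ s, hermiteFun (ν m) (ξ m) :=
  Finsupp.prod_of_support_subset _ h _ fun _ _ => hermiteFun_zero _

theorem measurable_hermiteFun (n : ℕ) : Measurable (hermiteFun n) :=
  (continuous_hermiteFun n).measurable

theorem memLp_hermiteMulti (ν : ℕ →₀ ℕ) : MemLp (hermiteMulti ν) 2 gaussMeasure :=
  memLp_prod_gaussMeasure ν.support (fun m => hermiteFun (ν m))
    (fun _ => measurable_hermiteFun _) fun _ _ => memLp_hermiteFun _

theorem integral_hermiteMulti_mul (ν κ : ℕ →₀ ℕ) :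
    ∫ ξ, hermiteMulti ν ξ * hermiteMulti κ ξ ∂gaussMeasure = if ν = κ then 1 else 0 := by
  have h : ∀ ξ : ℕ → ℝ, hermiteMulti ν ξ * hermiteMulti κ ξ =
      ∏ m ∈ ν.support ∪ κ.support, hermiteFun (ν m) (ξ m) * hermiteFun (κ m) (ξ m) := by
    intro ξ
    rw [hermiteMulti_eq_prod Finset.subset_union_left, hermiteMulti_eq_prod
      Finset.subset_union_right, Finset.prod_mul_distrib]
  simp only [h]
  rw [integral_prod_gaussMeasure _ (fun m t => hermiteFun (ν m) t * hermiteFun (κ m) t)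
    fun _ => (measurable_hermiteFun _).mul (measurable_hermiteFun _)]
  simp only [integral_hermiteFun_mul]
  rw [Finset.prod_ite_zero, Finset.prod_const_one]
  congr 1
  refine propext ⟨fun hs => Finsupp.ext fun m => ?_, fun h m _ => by rw [h]⟩
  by_cases hm : m ∈ ν.support ∪ κ.support
  · exact hs m hm
  · simp only [Finset.mem_union, Finsupp.mem_support_iff, not_or, not_not] at hm
    rw [hm.1, hm.2]

end SparseCollocation

namespace SparseCollocation

/-! ### Completeness of the Hermite system -/

theorem hermiteMulti_split {ν κ : ℕ →₀ ℕ} {m : ℕ} (h : ∀ j, j ≠ m → κ j = ν j) (ξ : ℕ → ℝ) :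
    hermiteMulti κ ξ =
      hermiteFun (κ m) (ξ m) * ∏ j ∈ ν.support.erase m, hermiteFun (ν j) (ξ j) := by
  classical
  have hs : κ.support ⊆ insert m ν.support := by
    intro j hj
    by_cases hjm : j = m
    · simp [hjm]
    · simp only [Finsupp.mem_support_iff, h j hjm] at hj
      simp [hj]
  rw [hermiteMulti_eq_prod hs, ← Finset.mul_prod_erase _ _ (Finset.mem_insert_self m _),
    Finset.erase_insert_eq_erase]
  congr 1
  exact Finset.prod_congr rfl fun j hj => by rw [h j (Finset.ne_of_mem_erase hj)]

theorem coord_mul_hermiteMulti (m : ℕ) (ν : ℕ →₀ ℕ) (ξ : ℕ → ℝ) :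
    ξ m * hermiteMulti ν ξ =
      √(ν m + 1 : ℝ) * hermiteMulti (ν + Finsupp.single m 1) ξ +
        √(ν m : ℝ) * hermiteMulti (ν - Finsupp.single m 1) ξ := by
  rw [hermiteMulti_split (ν := ν) (κ := ν) (m := m) (fun _ _ => rfl),
    hermiteMulti_split (ν := ν) (κ := ν + Finsupp.single m 1) (m := m)
      (fun j hj => by simp [Finsupp.single_eq_of_ne hj]),
    hermiteMulti_split (ν := ν) (κ := ν - Finsupp.single m 1) (m := m)
      (fun j hj => by simp [Finsupp.single_eq_of_ne hj]), ← mul_assoc, mul_hermiteFun]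
  simp
  ring

/-- The linear span of the tensor product Hermite polynomials. -/
def hermiteSpan : Submodule ℝ ((ℕ → ℝ) → ℝ) := Submodule.span ℝ (Set.range hermiteMulti)

theorem coord_mul_mem_hermiteSpan (m : ℕ) {q : (ℕ → ℝ) → ℝ} (hq : q ∈ hermiteSpan) :
    (fun ξ => ξ m * q ξ) ∈ hermiteSpan := by
  induction hq using Submodule.span_induction with
  | mem q hq =>
    obtain ⟨ν, rfl⟩ := hq
    have : (fun ξ : ℕ → ℝ => ξ m * hermiteMulti ν ξ) =
        √(ν m + 1 : ℝ) • hermiteMulti (ν + Finsupp.single m 1) +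
          √(ν m : ℝ) • hermiteMulti (ν - Finsupp.single m 1) :=
      funext fun ξ => coord_mul_hermiteMulti m ν ξ
    rw [this]
    exact add_mem (Submodule.smul_mem _ _ (Submodule.subset_span ⟨_, rfl⟩))
      (Submodule.smul_mem _ _ (Submodule.subset_span ⟨_, rfl⟩))
  | zero => simp only [Pi.zero_apply, mul_zero]; exact zero_mem _
  | add p q _ _ hp hq => simp only [Pi.add_apply, mul_add]; exact add_mem hp hq
  | smul a p _ hp =>
    simp only [Pi.smul_apply, smul_eq_mul, mul_left_comm _ a]
    exact Submodule.smul_mem _ a hp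

/-- The span is stable under multiplication by coordinates, by the three-term recurrence. Powers of
linear forms are all that the power series of a character needs. -/
theorem linear_pow_mem_hermiteSpan (I : Finset ℕ) (t : ℕ → ℝ) (n : ℕ) :
    (fun ξ => (∑ i ∈ I, t i * ξ i) ^ n) ∈ hermiteSpan := by
  induction n with
  | zero =>
    have : (fun ξ : ℕ → ℝ => (∑ i ∈ I, t i * ξ i) ^ 0) = hermiteMulti 0 := by
      funext ξ
      simp [hermiteMulti]
    rw [this]
    exact Submodule.subset_span ⟨_, rfl⟩
  | succ n ih =>
    have : (fun ξ : ℕ → ℝ => (∑ i ∈ I, t i * ξ i) ^ (n + 1)) =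
        ∑ i ∈ I, t i • fun ξ : ℕ → ℝ => ξ i * (∑ i ∈ I, t i * ξ i) ^ n := by
      funext ξ
      rw [pow_succ', Finset.sum_mul, Finset.sum_apply]
      exact Finset.sum_congr rfl fun i _ => by simp [mul_assoc]
    rw [this]
    exact sum_mem fun i _ => Submodule.smul_mem _ _ (coord_mul_mem_hermiteSpan i ih)

theorem integral_mul_eq_zero_of_mem_hermiteSpan {u : (ℕ → ℝ) → ℝ} (hu : MemLp u 2 gaussMeasure)
    (h : ∀ ν, ∫ ξ, hermiteMulti ν ξ * u ξ ∂gaussMeasure = 0) {q : (ℕ → ℝ) → ℝ}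
    (hq : q ∈ hermiteSpan) :
    MemLp q 2 gaussMeasure ∧ ∫ ξ, q ξ * u ξ ∂gaussMeasure = 0 := by
  induction hq using Submodule.span_induction with
  | mem q hq =>
    obtain ⟨ν, rfl⟩ := hq
    exact ⟨memLp_hermiteMulti ν, h ν⟩
  | zero => simp
  | add p q _ _ hp hq =>
    refine ⟨hp.1.add hq.1, ?_⟩
    simp only [Pi.add_apply, add_mul]
    have h1 : Integrable (fun ξ => p ξ * u ξ) gaussMeasure := hp.1.integrable_mul hu
    have h2 : Integrable (fun ξ => q ξ * u ξ) gaussMeasure := hq.1.integrable_mul hu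
    rw [integral_add h1 h2, hp.2, hq.2, add_zero]
  | smul a p _ hp =>
    refine ⟨hp.1.const_smul a, ?_⟩
    simp only [Pi.smul_apply, smul_eq_mul, mul_assoc]
    rw [integral_const_mul, hp.2, mul_zero]

theorem memLp_exp_mul_abs (t : ℝ) :
    MemLp (fun x => Real.exp (t * |x|)) 2 (gaussianReal 0 1) := by
  rw [memLp_two_iff_integrable_sq (by fun_prop)]
  refine ((integrable_exp_mul_gaussianReal (μ := 0) (v := 1) (2 * t)).add
    (integrable_exp_mul_gaussianReal (μ := 0) (v := 1) (-(2 * t)))).mono'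
    (by fun_prop) (ae_of_all _ fun x => ?_)
  rw [Real.norm_of_nonneg (by positivity), ← Real.exp_nat_mul]
  simp only [Pi.add_apply]
  have h1 := Real.exp_pos (2 * t * x)
  have h2 := Real.exp_pos (-(2 * t) * x)
  rcases abs_cases x with ⟨hx, _⟩ | ⟨hx, _⟩
  · rw [hx]
    push_cast
    rw [← mul_assoc]
    linarith
  · rw [hx]
    push_cast
    have : 2 * (t * -x) = -(2 * t) * x := by ring
    rw [this]
    linarith

theorem memLp_exp_abs_linear (I : Finset ℕ) (t : ℕ → ℝ) :
    MemLp (fun ξ : ℕ → ℝ => Real.exp |∑ i ∈ I, t i * ξ i|) 2 gaussMeasure := by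
  refine (memLp_prod_gaussMeasure I (fun i x => Real.exp (|t i| * |x|)) (fun i => by fun_prop)
    fun i _ => memLp_exp_mul_abs _).mono
      (by fun_prop : Measurable _).aestronglyMeasurable (ae_of_all _ fun ξ => ?_)
  rw [Real.norm_of_nonneg (by positivity), Real.norm_of_nonneg (by positivity), ← Real.exp_sum]
  refine Real.exp_le_exp.2 ((Finset.abs_sum_le_sum_abs _ _).trans (Finset.sum_le_sum fun i _ => ?_))
  rw [abs_mul]

/-- The exponential series may be integrated termwise: it is dominated by `exp |s| * |u|`, a product
of two `L²` functions, and each term integrates to zero since powers of `s` lie in the Hermite span.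
-/
theorem integral_exp_mul_eq_zero {u : (ℕ → ℝ) → ℝ} (hu : MemLp u 2 gaussMeasure)
    (h : ∀ ν, ∫ ξ, hermiteMulti ν ξ * u ξ ∂gaussMeasure = 0) (I : Finset ℕ) (t : ℕ → ℝ) :
    ∫ ξ : ℕ → ℝ, Complex.exp ((∑ i ∈ I, t i * ξ i : ℝ) * Complex.I) * (u ξ : ℂ) ∂gaussMeasure
      = 0 := by
  set s : (ℕ → ℝ) → ℝ := fun ξ => ∑ i ∈ I, t i * ξ i with hs
  have hsm : Measurable s := by fun_prop
  have key := hasSum_integral_of_dominated_convergence (μ := gaussMeasure)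
    (F := fun (n : ℕ) ξ => ((s ξ : ℂ) * Complex.I) ^ n / (n.factorial : ℂ) * (u ξ : ℂ))
    (f := fun ξ => Complex.exp ((s ξ : ℂ) * Complex.I) * (u ξ : ℂ))
    (fun n ξ => |s ξ| ^ n / n.factorial * |u ξ|) ?_ ?_ ?_ ?_ ?_
  · have hz : ∀ n : ℕ, ∫ ξ, ((s ξ : ℂ) * Complex.I) ^ n / (n.factorial : ℂ) * (u ξ : ℂ)
        ∂gaussMeasure = 0 := by
      intro n
      have h0 := (integral_mul_eq_zero_of_mem_hermiteSpan hu h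
        (linear_pow_mem_hermiteSpan I t n)).2
      have : ∀ ξ, ((s ξ : ℂ) * Complex.I) ^ n / (n.factorial : ℂ) * (u ξ : ℂ) =
          (Complex.I ^ n / (n.factorial : ℂ)) * (((s ξ) ^ n * u ξ : ℝ) : ℂ) := by
        intro ξ
        push_cast
        ring
      simp only [this]
      rw [integral_const_mul, integral_complex_ofReal, h0]
      simp
    simp only [hz] at key
    exact key.unique hasSum_zero
  · intro n
    exact ((by fun_prop : Measurable fun ξ => ((s ξ : ℂ) * Complex.I) ^ n / (n.factorial : ℂ))
      |>.aestronglyMeasurable).mul (Complex.continuous_ofReal.comp_aestronglyMeasurable hu.1)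
  · intro n
    refine ae_of_all _ fun ξ => le_of_eq ?_
    simp
  · exact ae_of_all _ fun ξ => (Real.summable_pow_div_factorial _).mul_right _
  · have : ∀ ξ, ∑' n : ℕ, |s ξ| ^ n / n.factorial * |u ξ| = Real.exp |s ξ| * |u ξ| := by
      intro ξ
      rw [tsum_mul_right, Real.exp_eq_exp_ℝ, NormedSpace.exp_eq_tsum_div]
    simp only [this]
    exact (memLp_exp_abs_linear I t).integrable_mul hu.norm
  · refine ae_of_all _ fun ξ => HasSum.mul_right _ ?_
    rw [Complex.exp_eq_exp_ℂ]
    exact NormedSpace.expSeries_div_hasSum_exp _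

/-- The Hermite polynomials are total in the real space `L²(μ)`. -/
theorem ae_eq_zero_of_integral_hermiteMulti_mul {u : (ℕ → ℝ) → ℝ} (hu : MemLp u 2 gaussMeasure)
    (h : ∀ ν, ∫ ξ, hermiteMulti ν ξ * u ξ ∂gaussMeasure = 0) : u =ᵐ[gaussMeasure] 0 := by
  have hui : Integrable u gaussMeasure := hu.integrable one_le_two
  -- The positive and negative parts of `u` are densities of two finite measures. Equal
  -- characteristic functions of all finite-dimensional marginals force these measures to agree.
  set νp := gaussMeasure.withDensity fun ξ => ENNReal.ofReal (u ξ) with hνp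
  set νm := gaussMeasure.withDensity fun ξ => ENNReal.ofReal (-u ξ) with hνm
  have hp : IsFiniteMeasure νp := isFiniteMeasure_withDensity_ofReal hui.2
  have hm : IsFiniteMeasure νm := isFiniteMeasure_withDensity_ofReal hui.neg.2
  have mp : AEMeasurable (fun ξ => ENNReal.ofReal (u ξ)) gaussMeasure :=
    hui.aemeasurable.ennreal_ofReal
  have mm : AEMeasurable (fun ξ => ENNReal.ofReal (-u ξ)) gaussMeasure :=
    hui.neg.aemeasurable.ennreal_ofReal
  have heq : ∀ I : Finset ℕ, νp.map I.restrict = νm.map I.restrict := by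
    intro I
    refine Measure.ext_of_charFunDual ?_
    funext L
    -- These are the coordinates of the functional `L` in the standard basis.
    set t : ℕ → ℝ := fun i => if hi : i ∈ I then L (Pi.single ⟨i, hi⟩ 1) else 0 with ht
    have hL : ∀ ξ : ℕ → ℝ, L (I.restrict ξ) = ∑ i ∈ I, t i * ξ i := by
      intro ξ
      have h1 := L.toLinearMap.pi_apply_eq_sum_univ (I.restrict ξ)
      rw [← Finset.sum_coe_sort I]
      refine h1.trans (Finset.sum_congr rfl fun i _ => ?_)
      simp only [ht, i.2, dite_true, smul_eq_mul, Finset.restrict]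
      rw [mul_comm]
      congr 1
      exact congrArg L (funext fun j => by simp [Pi.single_apply, eq_comm])
    have hcont : Continuous fun v : I → ℝ => Complex.exp (L v * Complex.I) := by fun_prop
    rw [charFunDual_apply, charFunDual_apply,
      integral_map (Finset.measurable_restrict I).aemeasurable hcont.aestronglyMeasurable,
      integral_map (Finset.measurable_restrict I).aemeasurable hcont.aestronglyMeasurable,
      integral_withDensity_eq_integral_toReal_smul₀ mp (ae_of_all _ fun _ => ENNReal.ofReal_lt_top),
      integral_withDensity_eq_integral_toReal_smul₀ mm (ae_of_all _ fun _ => ENNReal.ofReal_lt_top),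
      ← sub_eq_zero]
    have hmeas : AEStronglyMeasurable
        (fun ξ : ℕ → ℝ => Complex.exp ((L (I.restrict ξ) : ℝ) * Complex.I)) gaussMeasure :=
      (hcont.measurable.comp (Finset.measurable_restrict I)).aestronglyMeasurable
    have hbd : ∀ ξ : ℕ → ℝ, ‖Complex.exp ((L (I.restrict ξ) : ℝ) * Complex.I)‖ ≤ 1 :=
      fun ξ => (Complex.norm_exp_ofReal_mul_I _).le
    have hip : ∀ {v : (ℕ → ℝ) → ℝ}, Integrable v gaussMeasure →
        Integrable (fun ξ : ℕ → ℝ => (ENNReal.ofReal (v ξ)).toReal •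
          Complex.exp ((L (I.restrict ξ) : ℝ) * Complex.I)) gaussMeasure := by
      intro v hv
      have := hv.pos_part
      refine ((this.ofReal (𝕜 := ℂ)).mul_bdd hmeas (ae_of_all _ hbd)).congr
          (ae_of_all _ fun ξ => ?_)
      simp [ENNReal.toReal_ofReal']
    refine (integral_sub (hip hui) (hip hui.neg)).symm.trans ?_
    rw [← integral_exp_mul_eq_zero hu h I t]
    congr 1 with ξ
    rw [← sub_smul, ENNReal.toReal_ofReal', ENNReal.toReal_ofReal', hL]
    have : max (u ξ) 0 - max (-u ξ) 0 = u ξ := max_zero_sub_eq_self _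
    simp only [Pi.neg_apply, this, Complex.real_smul]
    ring
  have hν : νp = νm := IsProjectiveLimit.unique (P := fun I : Finset ℕ => νm.map I.restrict)
    (fun I => heq I) (fun I => rfl)
  have hae := (withDensity_eq_iff mp mm (by
    simpa [hνp] using (measure_ne_top νp Set.univ))).1 hν
  filter_upwards [hae] with ξ hξ
  have h1 : max (u ξ) 0 - max (-u ξ) 0 = u ξ := max_zero_sub_eq_self _
  have h2 := congrArg ENNReal.toReal hξ
  rw [ENNReal.toReal_ofReal', ENNReal.toReal_ofReal'] at h2
  rw [h2, sub_self] at h1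
  exact h1.symm

end SparseCollocation

namespace SparseCollocation

/-! ### Hermite expansions of vector-valued functions -/

section LpSpace

variable {H : Type*} [NormedAddCommGroup H] [InnerProductSpace ℝ H]

theorem eLpNorm_smul_vec {g : (ℕ → ℝ) → ℝ} (h : H) :
    eLpNorm (fun ξ => g ξ • h) 2 gaussMeasure = eLpNorm g 2 gaussMeasure * ‖h‖ₑ := by
  rw [eLpNorm_congr_norm_ae (g := fun ξ => ‖h‖ • g ξ)
    (ae_of_all _ fun ξ => by simp [norm_smul, mul_comm])]
  have := eLpNorm_const_smul (‖h‖) g 2 gaussMeasure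
  rw [enorm_norm, mul_comm] at this
  exact this

theorem memLp_smul_vec {g : (ℕ → ℝ) → ℝ} (hg : MemLp g 2 gaussMeasure) (h : H) :
    MemLp (fun ξ => g ξ • h) 2 gaussMeasure := by
  refine ⟨hg.1.smul_const h, ?_⟩
  rw [eLpNorm_smul_vec]
  exact ENNReal.mul_lt_top hg.2 enorm_lt_top

/-- The map `h ↦ g • h` from `H` to `L²(μ; H)`. -/
def smulLp (g : (ℕ → ℝ) → ℝ) (hg : MemLp g 2 gaussMeasure) : H →L[ℝ] Lp H 2 gaussMeasure :=
  LinearMap.mkContinuous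
    { toFun := fun h => (memLp_smul_vec hg h).toLp _
      map_add' := fun h h' => by
        rw [← MemLp.toLp_add]
        exact MemLp.toLp_congr _ _ (ae_of_all _ fun ξ => smul_add _ _ _)
      map_smul' := fun c h => by
        rw [RingHom.id_apply, ← MemLp.toLp_const_smul]
        exact MemLp.toLp_congr _ _ (ae_of_all _ fun ξ => smul_comm _ _ _) }
    (eLpNorm g 2 gaussMeasure).toReal fun h => by
      simp [Lp.norm_toLp, eLpNorm_smul_vec, ENNReal.toReal_mul]

theorem smulLp_apply {g : (ℕ → ℝ) → ℝ} (hg : MemLp g 2 gaussMeasure) (h : H) :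
    smulLp g hg h = (memLp_smul_vec hg h).toLp _ := rfl

theorem norm_smulLp {g : (ℕ → ℝ) → ℝ} (hg : MemLp g 2 gaussMeasure) (h : H) :
    ‖smulLp g hg h‖ = (eLpNorm g 2 gaussMeasure).toReal * ‖h‖ := by
  simp [smulLp_apply, Lp.norm_toLp, eLpNorm_smul_vec, ENNReal.toReal_mul]

theorem coeFn_smulLp {g : (ℕ → ℝ) → ℝ} (hg : MemLp g 2 gaussMeasure) (h : H) :
    smulLp g hg h =ᵐ[gaussMeasure] fun ξ => g ξ • h :=
  (memLp_smul_vec hg h).coeFn_toLp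

theorem integrable_smul_of_memLp {g : (ℕ → ℝ) → ℝ} {u : (ℕ → ℝ) → H}
    (hg : MemLp g 2 gaussMeasure) (hu : MemLp u 2 gaussMeasure) :
    Integrable (fun ξ => g ξ • u ξ) gaussMeasure :=
  memLp_one_iff_integrable.1 (hu.smul hg)

theorem inner_smulLp [CompleteSpace H] {g : (ℕ → ℝ) → ℝ} (hg : MemLp g 2 gaussMeasure) (h : H)
    (u : Lp H 2 gaussMeasure) :
    inner ℝ (smulLp g hg h) u = inner ℝ h (∫ ξ, g ξ • u ξ ∂gaussMeasure) := by
  rw [L2.inner_def, ← integral_inner (integrable_smul_of_memLp hg (Lp.memLp u))]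
  refine integral_congr_ae ?_
  filter_upwards [coeFn_smulLp hg h] with ξ hξ
  rw [hξ, inner_smul_left, inner_smul_right]
  rfl

theorem hermiteCoeff_congr {F G : (ℕ → ℝ) → H} (h : F =ᵐ[gaussMeasure] G) (ν : ℕ →₀ ℕ) :
    hermiteCoeff F ν = hermiteCoeff G ν :=
  integral_congr_ae (h.mono fun ξ hξ => by simp only [hξ])

/-- The isometry `h ↦ H_ν • h`. -/
abbrev hermiteLp (ν : ℕ →₀ ℕ) : H →L[ℝ] Lp H 2 gaussMeasure :=
  smulLp (hermiteMulti ν) (memLp_hermiteMulti ν)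

theorem inner_hermiteLp_left [CompleteSpace H] (ν : ℕ →₀ ℕ) (h : H) (u : Lp H 2 gaussMeasure) :
    inner ℝ (hermiteLp ν h) u = inner ℝ h (hermiteCoeff u ν) :=
  inner_smulLp _ h u

theorem inner_hermiteLp_hermiteLp [CompleteSpace H] (ν κ : ℕ →₀ ℕ) (h h' : H) :
    inner ℝ (hermiteLp ν h) (hermiteLp κ h') = if ν = κ then inner ℝ h h' else 0 := by
  rw [inner_hermiteLp_left, hermiteCoeff_congr (coeFn_smulLp _ _)]
  simp only [hermiteCoeff, smul_smul]
  rw [integral_smul_const, integral_hermiteMulti_mul]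
  split_ifs <;> simp

/-- Bessel's inequality. -/
theorem sum_norm_hermiteCoeff_sq_le [CompleteSpace H] {F : (ℕ → ℝ) → H}
    (hF : MemLp F 2 gaussMeasure) (S : Finset (ℕ →₀ ℕ)) :
    ∑ ν ∈ S, ‖hermiteCoeff F ν‖ ^ 2 ≤ (eLpNorm F 2 gaussMeasure).toReal ^ 2 := by
  set u := hF.toLp F with hu
  have hc : ∀ ν, hermiteCoeff u ν = hermiteCoeff F ν := fun ν =>
    hermiteCoeff_congr hF.coeFn_toLp ν
  set P := ∑ ν ∈ S, hermiteLp ν (hermiteCoeff F ν) with hP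
  have h1 : inner ℝ P u = ∑ ν ∈ S, ‖hermiteCoeff F ν‖ ^ 2 := by
    simp only [hP, sum_inner, inner_hermiteLp_left, hc, real_inner_self_eq_norm_sq]
  have h2 : inner ℝ P P = ∑ ν ∈ S, ‖hermiteCoeff F ν‖ ^ 2 := by
    simp only [hP, sum_inner, inner_sum, inner_hermiteLp_hermiteLp]
    refine Finset.sum_congr rfl fun ν hν => ?_
    rw [Finset.sum_ite_eq', if_pos hν, real_inner_self_eq_norm_sq]
  have h3 : 0 ≤ ‖u - P‖ ^ 2 := sq_nonneg _
  rw [norm_sub_sq_real, real_inner_comm, h1, ← real_inner_self_eq_norm_sq P, h2, hu,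
    Lp.norm_toLp] at h3
  linarith

/-- Absolute summability already provides some limit, and it has the same coefficients as `F`.
Scalar completeness, applied to `⟪h, w⟫` for each `h`, kills the difference `w`; separability turns
this into `w = 0` almost everywhere. -/
theorem hasSum_hermiteLp [CompleteSpace H] [TopologicalSpace.SeparableSpace H] {F : (ℕ → ℝ) → H}
    (hF : MemLp F 2 gaussMeasure) (hs : Summable fun ν => ‖hermiteCoeff F ν‖) :
    HasSum (fun ν => hermiteLp ν (hermiteCoeff F ν)) (hF.toLp F) := by
  have hnorm : ∀ (ν : ℕ →₀ ℕ) (h : H), ‖hermiteLp ν h‖ = ‖h‖ := by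
    intro ν h
    rw [← sq_eq_sq₀ (norm_nonneg _) (norm_nonneg _), ← real_inner_self_eq_norm_sq,
      inner_hermiteLp_hermiteLp, if_pos rfl, real_inner_self_eq_norm_sq]
  have _ : SecondCountableTopology H := UniformSpace.secondCountable_of_separable H
  have hsum : Summable fun ν => hermiteLp ν (hermiteCoeff F ν) := by
    refine Summable.of_norm ?_
    simpa only [hnorm] using hs
  obtain ⟨G, hG⟩ := hsum
  suffices h : hF.toLp F - G = 0 by rwa [sub_eq_zero.1 h]
  set w := hF.toLp F - G with hw
  have hcoef : ∀ (κ : ℕ →₀ ℕ) (h : H), inner ℝ (hermiteLp κ h) w = 0 := by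
    intro κ h
    have h1 := hG.mapL (innerSL ℝ (hermiteLp κ h))
    simp only [innerSL_apply_apply, inner_hermiteLp_hermiteLp] at h1
    have h2 := h1.unique (hasSum_single κ fun ν hν => if_neg hν.symm)
    rw [if_pos rfl] at h2
    rw [hw, inner_sub_right, h2, inner_hermiteLp_left, hermiteCoeff_congr hF.coeFn_toLp, sub_self]
  rw [Lp.eq_zero_iff_ae_eq_zero]
  refine ae_eq_zero_of_forall_inner (𝕜 := ℝ) fun h => ?_
  refine ae_eq_zero_of_integral_hermiteMulti_mul ((Lp.memLp w).const_inner h) fun ν => ?_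
  have h1 := hcoef ν h
  rw [inner_hermiteLp_left, hermiteCoeff,
    ← integral_inner (integrable_smul_of_memLp (memLp_hermiteMulti ν) (Lp.memLp w))] at h1
  simpa only [inner_smul_right] using h1

end LpSpace

end SparseCollocation

namespace SparseCollocation

/-! ### Hermite coefficients of weak derivatives -/

/-- Dilate one bump by `N + 1 ≥ 1`, which does not increase the bound on the derivative. Being equal
to `1` near each point, and not only at it, lets derivatives of the truncated functions converge as
well. -/
theorem exists_cutoff : ∃ (χ : ℕ → ℝ → ℝ) (B : ℝ), (∀ N, ContDiff ℝ ∞ (χ N)) ∧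
    (∀ N, HasCompactSupport (χ N)) ∧ (∀ N t, |χ N t| ≤ 1) ∧ (∀ N t, |deriv (χ N) t| ≤ B) ∧
    ∀ t, ∀ᶠ N in Filter.atTop, χ N =ᶠ[nhds t] fun _ => 1 := by
  let b : ContDiffBump (0 : ℝ) := ⟨1, 2, one_pos, one_lt_two⟩
  have hb : ContDiff ℝ ∞ b := b.contDiff
  obtain ⟨B, hB⟩ := (hb.continuous_deriv (by simp)).bounded_above_of_compact_support
    b.hasCompactSupport.deriv
  have hpos : ∀ N : ℕ, (0 : ℝ) < N + 1 := fun N => by positivity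
  refine ⟨fun N t => b ((N + 1 : ℝ)⁻¹ * t), B, fun N => ?_, fun N => ?_, fun N t => ?_,
    fun N t => ?_, fun t => ?_⟩
  · exact hb.comp (contDiff_const.mul contDiff_id)
  · exact b.hasCompactSupport.comp_homeomorph (Homeomorph.mulLeft₀ _ (inv_ne_zero (hpos N).ne'))
  · rw [abs_of_nonneg b.nonneg]
    exact b.le_one
  · have h1 := ((hb.differentiable (by simp)) ((N + 1 : ℝ)⁻¹ * t)).hasDerivAt.comp t
      ((hasDerivAt_id t).const_mul ((N + 1 : ℝ)⁻¹))
    have h2 : deriv (fun t => b ((N + 1 : ℝ)⁻¹ * t)) t =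
        deriv b ((N + 1 : ℝ)⁻¹ * t) * ((N + 1 : ℝ)⁻¹ * 1) := h1.deriv
    rw [h2, abs_mul, mul_one, abs_of_pos (inv_pos.2 (hpos N))]
    have h3 := hB ((N + 1 : ℝ)⁻¹ * t)
    rw [Real.norm_eq_abs] at h3
    have h4 : (N + 1 : ℝ)⁻¹ ≤ 1 := inv_le_one_of_one_le₀ (by
      have : (0 : ℝ) ≤ N := N.cast_nonneg
      linarith)
    exact (mul_le_of_le_one_right (abs_nonneg _) h4).trans h3
  · obtain ⟨N₀, hN₀⟩ := exists_nat_gt |t|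
    filter_upwards [Filter.eventually_ge_atTop N₀] with N hN
    have hlt : |t| < N + 1 := by
      have : (N₀ : ℝ) ≤ N := by exact_mod_cast hN
      linarith
    have hopen : {s : ℝ | |s| < N + 1} ∈ nhds t :=
      (isOpen_lt continuous_abs continuous_const).mem_nhds hlt
    filter_upwards [hopen] with s hs
    refine b.one_of_mem_closedBall ?_
    rw [mem_closedBall_zero_iff, norm_mul, Real.norm_eq_abs, Real.norm_eq_abs,
      abs_of_pos (inv_pos.2 (hpos N))]
    exact (inv_mul_le_one₀ (hpos N)).2 (le_of_lt hs)

theorem isTestFunction_prod (n : ℕ) (a : ℕ → ℝ → ℝ) (ha : ∀ j, ContDiff ℝ ∞ (a j))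
    (hc : ∀ j, HasCompactSupport (a j)) :
    IsTestFunction fun ξ => ∏ j ∈ Finset.range n, a j (ξ j) := by
  refine ⟨n, fun y => ∏ j : Fin n, a j (y j), ?_, ?_, ?_⟩
  · exact contDiff_prod fun j _ => (ha j).comp (contDiff_apply ℝ ℝ j)
  · refine HasCompactSupport.intro (isCompact_univ_pi fun j : Fin n => hc j) fun y hy => ?_
    simp only [Set.mem_univ_pi, not_forall] at hy
    obtain ⟨j, hj⟩ := hy
    exact Finset.prod_eq_zero (Finset.mem_univ j) (image_eq_zero_of_notMem_tsupport hj)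
  · funext ξ
    exact (Finset.prod_range fun j => a j (ξ j))

theorem partialDeriv_prod {s : Finset ℕ} {m : ℕ} (hm : m ∈ s) (a : ℕ → ℝ → ℝ) (ξ : ℕ → ℝ) :
    partialDeriv m (fun ξ => ∏ j ∈ s, a j (ξ j)) ξ =
      deriv (a m) (ξ m) * ∏ j ∈ s.erase m, a j (ξ j) := by
  unfold partialDeriv
  have : (fun t => ∏ j ∈ s, a j (Function.update ξ m t j)) =
      fun t => a m t * ∏ j ∈ s.erase m, a j (ξ j) := by
    funext t
    rw [← Finset.mul_prod_erase _ _ hm, Function.update_self]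
    congr 1
    exact Finset.prod_congr rfl fun j hj => by
      rw [Function.update_of_ne (Finset.ne_of_mem_erase hj)]
  rw [this, deriv_mul_const_field]

variable {H : Type*} [NormedAddCommGroup H] [InnerProductSpace ℝ H]

/-- Formally this is integration by parts against `H_ν`, with `ξ_m H_ν - ∂_m H_ν = √(ν_m + 1) H_(ν +
e_m)`. As `H_ν` is not compactly supported, every relevant coordinate is cut off and the cutoff
removed by dominated convergence. -/
theorem hermiteCoeff_weakPartial {m : ℕ} {g h : (ℕ → ℝ) → H} (hg : MemLp g 2 gaussMeasure)
    (hh : MemLp h 2 gaussMeasure) (hw : IsWeakPartial m g h) (ν : ℕ →₀ ℕ) :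
    hermiteCoeff h ν = √(ν m + 1 : ℝ) • hermiteCoeff g (ν + Finsupp.single m 1) := by
  classical
  obtain ⟨χ, B, hχ, hχc, hχ1, hχB, hχt⟩ := exists_cutoff
  obtain ⟨n, hn⟩ : ∃ n, insert m ν.support ⊆ Finset.range n :=
    ⟨_, Finset.subset_range_sup_succ _⟩
  have hmn : m ∈ Finset.range n := hn (Finset.mem_insert_self _ _)
  have hνn : ν.support ⊆ Finset.range n := (Finset.subset_insert _ _).trans hn
  have hB : 0 ≤ B := (abs_nonneg _).trans (hχB 0 0)
  set a : ℕ → ℕ → ℝ → ℝ := fun N j t => hermiteFun (ν j) t * χ N t with ha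
  have had : ∀ N j, ContDiff ℝ ∞ (a N j) := fun N j => (contDiff_hermiteFun _).mul (hχ N)
  have hac : ∀ N j, Continuous (a N j) := fun N j => (had N j).continuous
  have ha1 : ∀ N j t, |a N j t| ≤ |hermiteFun (ν j) t| := fun N j t => by
    rw [ha, abs_mul]
    exact mul_le_of_le_one_right (abs_nonneg _) (hχ1 N t)
  have hat : ∀ j t, ∀ᶠ N in Filter.atTop, a N j =ᶠ[nhds t] hermiteFun (ν j) := fun j t => by
    filter_upwards [hχt t] with N hN
    filter_upwards [hN] with s hs
    simp [ha, hs]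
  have haB : ∀ N j t, |deriv (a N j) t| ≤
      |deriv (hermiteFun (ν j)) t| + B * |hermiteFun (ν j) t| := fun N j t => by
    have h1 : deriv (a N j) t = deriv (hermiteFun (ν j)) t * χ N t +
        hermiteFun (ν j) t * deriv (χ N) t :=
      deriv_fun_mul ((contDiff_hermiteFun _).differentiable (by simp) t)
        ((hχ N).differentiable (by simp) t)
    rw [h1]
    refine (abs_add_le _ _).trans (add_le_add ?_ ?_)
    · rw [abs_mul]
      exact mul_le_of_le_one_right (abs_nonneg _) (hχ1 N t)
    · rw [abs_mul, mul_comm]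
      exact mul_le_mul_of_nonneg_right (hχB N t) (abs_nonneg _)
  set φ : ℕ → (ℕ → ℝ) → ℝ := fun N ξ => ∏ j ∈ Finset.range n, a N j (ξ j) with hφ
  set P : (ℕ → ℝ) → ℝ := fun ξ => ∏ j ∈ (Finset.range n).erase m, hermiteFun (ν j) (ξ j) with hP
  set d : ℕ → (ℕ → ℝ) → ℝ := fun N ξ => (ξ m * a N m (ξ m) - deriv (a N m) (ξ m)) *
    ∏ j ∈ (Finset.range n).erase m, a N j (ξ j) with hd
  have hid : ∀ N, ∫ ξ, φ N ξ • h ξ ∂gaussMeasure = ∫ ξ, d N ξ • g ξ ∂gaussMeasure := by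
    intro N
    rw [hw (φ N) (isTestFunction_prod n _ (had N) fun j => (hχc N).mul_left)]
    congr 1 with ξ
    congr 1
    rw [partialDeriv_prod hmn]
    simp only [hφ, hd]
    rw [sub_mul, mul_assoc (ξ m), Finset.mul_prod_erase _ (fun j => a N j (ξ j)) hmn]
  have hev : ∀ ξ : ℕ → ℝ, ∀ᶠ N in Filter.atTop,
      ∀ j ∈ Finset.range n, a N j =ᶠ[nhds (ξ j)] hermiteFun (ν j) := fun ξ =>
    (Filter.eventually_all_finset _).2 fun j _ => hat j (ξ j)
  have lim1 : Filter.Tendsto (fun N => ∫ ξ, φ N ξ • h ξ ∂gaussMeasure) Filter.atTop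
      (nhds (hermiteCoeff h ν)) := by
    refine tendsto_integral_of_dominated_convergence (fun ξ => |hermiteMulti ν ξ| * ‖h ξ‖)
      (fun N => ?_) ?_ (fun N => ae_of_all _ fun ξ => ?_) (ae_of_all _ fun ξ => ?_)
    · refine AEStronglyMeasurable.smul (Measurable.aestronglyMeasurable ?_) hh.1
      exact Finset.measurable_fun_prod _ fun j _ => (hac N j).measurable.comp (measurable_pi_apply j)
    · exact (memLp_hermiteMulti ν).norm.integrable_mul hh.norm
    · rw [norm_smul, hermiteMulti_eq_prod hνn, Finset.abs_prod, Real.norm_eq_abs, Finset.abs_prod]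
      exact mul_le_mul_of_nonneg_right
        (Finset.prod_le_prod (fun _ _ => abs_nonneg _) fun j _ => ha1 N j _) (norm_nonneg _)
    · refine tendsto_const_nhds.congr' ?_
      filter_upwards [hev ξ] with N hN
      rw [hermiteMulti_eq_prod hνn, hφ]
      congr 1
      exact Finset.prod_congr rfl fun j hj => ((hN j hj).self_of_nhds).symm
  -- A majorant in product form, independent of the cutoff: only coordinate `m` carries the
  -- multiplication and the derivative, including the term from differentiating the cutoff.
  set G : ℕ → ℝ → ℝ := fun j t => if j = m then
    |t * hermiteFun (ν j) t| + (|deriv (hermiteFun (ν j)) t| + B * |hermiteFun (ν j) t|)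
    else |hermiteFun (ν j) t| with hG
  have hderc : ∀ k, Continuous (deriv (hermiteFun k)) := fun k =>
    (contDiff_hermiteFun k).continuous_deriv (by simp)
  have hGc : ∀ j, Continuous (G j) := by
    intro j
    have h1 := continuous_hermiteFun (ν j)
    have h2 := hderc (ν j)
    by_cases hj : j = m
    · simp only [hG, hj, if_true]
      rw [hj] at h1 h2
      fun_prop
    · simp only [hG, hj, if_false]
      exact h1.abs
  have hG2 : ∀ j, MemLp (G j) 2 (gaussianReal 0 1) := by
    intro j
    have h1 := memLp_hermiteFun (ν j)
    by_cases hj : j = m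
    · simp only [hG, hj, if_true]
      rw [hj] at h1
      refine MemLp.add ?_ (MemLp.add ?_ (h1.norm.const_mul B))
      · simp only [mul_hermiteFun]
        exact (((memLp_hermiteFun _).const_mul _).add ((memLp_hermiteFun _).const_mul _)).norm
      · simp only [deriv_hermiteFun]
        exact ((memLp_hermiteFun _).const_mul _).norm
    · simp only [hG, hj, if_false]
      exact h1.norm
  have lim2 : Filter.Tendsto (fun N => ∫ ξ, d N ξ • g ξ ∂gaussMeasure) Filter.atTop
      (nhds (√(ν m + 1 : ℝ) • hermiteCoeff g (ν + Finsupp.single m 1))) := by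
    have hlim : √(ν m + 1 : ℝ) • hermiteCoeff g (ν + Finsupp.single m 1) =
        ∫ ξ : ℕ → ℝ, (√(ν m + 1 : ℝ) * hermiteMulti (ν + Finsupp.single m 1) ξ) • g ξ
          ∂gaussMeasure := by
      rw [hermiteCoeff, ← integral_smul]
      simp only [smul_smul]
    rw [hlim]
    refine tendsto_integral_of_dominated_convergence
      (fun ξ => (∏ j ∈ Finset.range n, G j (ξ j)) * ‖g ξ‖)
      (fun N => ?_) ?_ (fun N => ae_of_all _ fun ξ => ?_) (ae_of_all _ fun ξ => ?_)
    · refine AEStronglyMeasurable.smul (Measurable.aestronglyMeasurable ?_) hg.1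
      refine Measurable.mul ?_ (Finset.measurable_fun_prod _ fun j _ =>
        (hac N j).measurable.comp (measurable_pi_apply j))
      have h1 : Continuous fun t => t * a N m t - deriv (a N m) t :=
        (continuous_id.mul (hac N m)).sub ((had N m).continuous_deriv (by simp))
      exact h1.measurable.comp (measurable_pi_apply m)
    · exact (memLp_prod_gaussMeasure _ G (fun j => (hGc j).measurable)
        fun j _ => hG2 j).integrable_mul hg.norm
    · rw [norm_smul, ← Finset.mul_prod_erase _ _ hmn, Real.norm_eq_abs, hd, abs_mul,
        Finset.abs_prod]
      refine mul_le_mul_of_nonneg_right (mul_le_mul ?_ (Finset.prod_le_prod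
        (fun _ _ => abs_nonneg _) fun j hj => ?_) (Finset.prod_nonneg fun _ _ => abs_nonneg _) ?_)
        (norm_nonneg _)
      · simp only [hG, if_true]
        refine (abs_sub _ _).trans (add_le_add ?_ (haB N m _))
        rw [abs_mul, abs_mul (ξ m)]
        exact mul_le_mul_of_nonneg_left (ha1 N m _) (abs_nonneg _)
      · simp only [hG, Finset.ne_of_mem_erase hj, if_false]
        exact ha1 N j _
      · simp only [hG, if_true]
        positivity
    · refine tendsto_const_nhds.congr' ?_
      filter_upwards [hev ξ] with N hN
      congr 1
      have h1 : ∏ j ∈ (Finset.range n).erase m, a N j (ξ j) = P ξ :=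
        Finset.prod_congr rfl fun j hj => (hN j (Finset.mem_of_mem_erase hj)).self_of_nhds
      have h2 : P ξ = ∏ j ∈ ν.support.erase m, hermiteFun (ν j) (ξ j) := by
        symm
        refine Finset.prod_subset (Finset.erase_subset_erase _ hνn) fun j hj hj' => ?_
        have : ν j = 0 := by
          by_contra h0
          exact hj' (Finset.mem_erase.2 ⟨Finset.ne_of_mem_erase hj, Finsupp.mem_support_iff.2 h0⟩)
        rw [this, hermiteFun_zero]
      simp only [hd]
      rw [(hN m hmn).self_of_nhds, (hN m hmn).deriv_eq, deriv_hermiteFun,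
        mul_hermiteFun_sub_deriv, h1, h2, hermiteMulti_split (ν := ν) (m := m)
        (fun j hj => by simp [Finsupp.single_eq_of_ne hj])]
      simp only [Finsupp.add_apply, Finsupp.single_eq_same]
      ring
  refine tendsto_nhds_unique lim1 ?_
  simpa only [hid] using lim2

end SparseCollocation

namespace SparseCollocation

/-! ### Weighted summability of Hermite coefficients -/

/-- The factorial `ν! = ∏ₘ νₘ!` of a multi-index. -/
def multiFactorial (ν : ℕ →₀ ℕ) : ℝ := ν.prod fun _ k => (k.factorial : ℝ)

theorem multiFactorial_pos (ν : ℕ →₀ ℕ) : 0 < multiFactorial ν :=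
  Finset.prod_pos fun m _ => Nat.cast_pos.2 (ν m).factorial_pos

theorem multiFactorial_add_single (ν : ℕ →₀ ℕ) (m : ℕ) :
    multiFactorial (ν + Finsupp.single m 1) = (ν m + 1) * multiFactorial ν := by
  classical
  have h1 : (ν + Finsupp.single m 1).support ⊆ insert m ν.support := by
    intro j hj
    by_cases hjm : j = m
    · simp [hjm]
    · simpa [Finsupp.single_eq_of_ne hjm, hjm] using hj
  unfold multiFactorial
  rw [Finsupp.prod_of_support_subset _ h1 _ (by simp),
    Finsupp.prod_of_support_subset ν (Finset.subset_insert m _) _ (by simp),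
    ← Finset.mul_prod_erase _ _ (Finset.mem_insert_self m _),
    ← Finset.mul_prod_erase _ (fun j => ((ν j).factorial : ℝ)) (Finset.mem_insert_self m _),
    ← mul_assoc]
  congr 1
  · simp [Nat.factorial_succ]
  · exact Finset.prod_congr rfl fun j hj => by
      simp [Finsupp.single_eq_of_ne (Finset.ne_of_mem_erase hj)]

variable {H : Type*} [NormedAddCommGroup H] [InnerProductSpace ℝ H]

/-- Each derivative in direction `m` contributes a factor `ν_m + 1` to the squared norm, exactly the
ratio of consecutive factorials, so the order of differentiation is immaterial. -/
theorem norm_hermiteCoeff_deriv_sq {r : ℕ} {F : (ℕ → ℝ) → H} {D : (ℕ →₀ ℕ) → (ℕ → ℝ) → H}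
    (h0 : D 0 =ᵐ[gaussMeasure] F)
    (h2 : ∀ α : ℕ →₀ ℕ, (∀ j, α j ≤ r) → MemLp (D α) 2 gaussMeasure)
    (hD : ∀ (α : ℕ →₀ ℕ) (m : ℕ), (∀ j, (α + Finsupp.single m 1 : ℕ →₀ ℕ) j ≤ r) →
      IsWeakPartial m (D α) (D (α + Finsupp.single m 1)))
    (α : ℕ →₀ ℕ) (hα : ∀ j, α j ≤ r) (ν : ℕ →₀ ℕ) :
    multiFactorial ν * ‖hermiteCoeff (D α) ν‖ ^ 2 =
      multiFactorial (ν + α) * ‖hermiteCoeff F (ν + α)‖ ^ 2 := by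
  induction hk : α.degree generalizing α ν with
  | zero =>
    rw [Finsupp.degree_eq_zero_iff] at hk
    rw [hk, add_zero, hermiteCoeff_congr h0]
  | succ k ih =>
    have hne : α ≠ 0 := by
      rintro rfl
      simp at hk
    obtain ⟨m, hm⟩ := Finsupp.support_nonempty_iff.2 hne
    have hm1 : Finsupp.single m 1 ≤ α :=
      Finsupp.single_le_iff.2 (Nat.one_le_iff_ne_zero.2 (Finsupp.mem_support_iff.1 hm))
    obtain ⟨β, rfl⟩ : ∃ β, α = β + Finsupp.single m 1 := ⟨_, (tsub_add_cancel_of_le hm1).symm⟩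
    have hβ : ∀ j, β j ≤ r := fun j => le_trans (by simp) (hα j)
    have hβk : β.degree = k := by
      rw [map_add, Finsupp.degree_single] at hk
      omega
    rw [hermiteCoeff_weakPartial (h2 β hβ) (h2 _ hα) (hD β m hα), norm_smul, mul_pow,
      Real.norm_of_nonneg (Real.sqrt_nonneg _), Real.sq_sqrt (by positivity), ← mul_assoc,
      mul_comm (multiFactorial ν), ← multiFactorial_add_single, ih β hβ _ hβk]
    rw [add_right_comm, add_assoc]

/-- The order of differentiation used for a coordinate of polynomial degree `n`. -/
def derivOrder (r n : ℕ) : ℕ := if n = 0 then 0 else if n < r then 1 else r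

theorem derivOrder_zero (r : ℕ) : derivOrder r 0 = 0 := rfl

theorem derivOrder_le (r n : ℕ) : derivOrder r n ≤ n := by
  unfold derivOrder
  split_ifs <;> omega

theorem derivOrder_le' {r : ℕ} (hr : 1 ≤ r) (n : ℕ) : derivOrder r n ≤ r := by
  unfold derivOrder
  split_ifs <;> omega

/-- The multi-index of differentiation used for the Hermite index `ν`. -/
def derivIndex (r : ℕ) (ν : ℕ →₀ ℕ) : ℕ →₀ ℕ := ν.mapRange (derivOrder r) (derivOrder_zero r)

theorem derivIndex_le (r : ℕ) (ν : ℕ →₀ ℕ) : derivIndex r ν ≤ ν := fun m => derivOrder_le r (ν m)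

/-- The weight `∏ₘ (νₘ choose αₘ) τₘ^{2αₘ}` for `α = derivIndex r ν`. -/
def hermiteWeight (τ : ℕ → ℝ) (r : ℕ) (ν : ℕ →₀ ℕ) : ℝ :=
  ν.prod fun m n => (n.choose (derivOrder r n) : ℝ) * τ m ^ (2 * derivOrder r n)

theorem hermiteWeight_mul (τ : ℕ → ℝ) (r : ℕ) (ν : ℕ →₀ ℕ) :
    hermiteWeight τ r ν * multiFactorial (ν - derivIndex r ν) =
      ((derivIndex r ν).prod fun m k => τ m ^ (2 * k)) /
        ((derivIndex r ν).prod fun _ k => (k.factorial : ℝ)) * multiFactorial ν := by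
  have hs1 : (derivIndex r ν).support ⊆ ν.support := Finsupp.support_mono (derivIndex_le r ν)
  have hs2 : (ν - derivIndex r ν).support ⊆ ν.support := Finsupp.support_mono tsub_le_self
  unfold multiFactorial hermiteWeight
  rw [Finsupp.prod_of_support_subset _ hs1 _ (by simp),
    Finsupp.prod_of_support_subset _ hs1 _ (by simp),
    Finsupp.prod_of_support_subset _ hs2 _ (by simp), Finsupp.prod, Finsupp.prod,
    ← Finset.prod_div_distrib, ← Finset.prod_mul_distrib, ← Finset.prod_mul_distrib]
  refine Finset.prod_congr rfl fun m _ => ?_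
  have h := Nat.choose_mul_factorial_mul_factorial (derivOrder_le r (ν m))
  have h1 : ((derivOrder r (ν m)).factorial : ℝ) ≠ 0 := by exact_mod_cast Nat.factorial_ne_zero _
  simp only [derivIndex, Finsupp.mapRange_apply, Finsupp.tsub_apply]
  rw [← h]
  push_cast
  field_simp

/-- Group the indices `ν` by `α = derivIndex r ν`. On one group `ν ↦ ν - α` is injective, so
Bessel's inequality for `∂^α F` bounds it by the `α`-term of the smoothness sum. -/
theorem summable_hermiteWeight_mul [CompleteSpace H] {r : ℕ} (hr : 1 ≤ r) {τ : ℕ → ℝ}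
    (hτ : ∀ m, 0 < τ m) {F : (ℕ → ℝ) → H} {D : (ℕ →₀ ℕ) → (ℕ → ℝ) → H}
    (h0 : D 0 =ᵐ[gaussMeasure] F)
    (h2 : ∀ α : ℕ →₀ ℕ, (∀ j, α j ≤ r) → MemLp (D α) 2 gaussMeasure)
    (hD : ∀ (α : ℕ →₀ ℕ) (m : ℕ), (∀ j, (α + Finsupp.single m 1 : ℕ →₀ ℕ) j ≤ r) →
      IsWeakPartial m (D α) (D (α + Finsupp.single m 1)))
    (hsum : Summable fun α : {α : ℕ →₀ ℕ // ∀ j, α j ≤ r} =>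
        (α.1.prod fun m k => τ m ^ (2 * k)) / (α.1.prod fun _ k => (k.factorial : ℝ)) *
          (eLpNorm (D α.1) 2 gaussMeasure).toReal ^ 2) :
    Summable fun ν => hermiteWeight τ r ν * ‖hermiteCoeff F ν‖ ^ 2 := by
  classical
  set q : (ℕ →₀ ℕ) → ℝ := fun α =>
    (α.prod fun m k => τ m ^ (2 * k)) / (α.prod fun _ k => (k.factorial : ℝ)) with hq
  have hq0 : ∀ α, 0 ≤ q α := fun α => div_nonneg
    (Finset.prod_nonneg fun m _ => pow_nonneg (hτ m).le _) (multiFactorial_pos α).le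
  have hidx : ∀ ν j, derivIndex r ν j ≤ r := fun ν j => derivOrder_le' hr _
  have hterm : ∀ ν, hermiteWeight τ r ν * ‖hermiteCoeff F ν‖ ^ 2 =
      q (derivIndex r ν) * ‖hermiteCoeff (D (derivIndex r ν)) (ν - derivIndex r ν)‖ ^ 2 := by
    intro ν
    have h1 := norm_hermiteCoeff_deriv_sq h0 h2 hD (derivIndex r ν) (hidx ν) (ν - derivIndex r ν)
    rw [tsub_add_cancel_of_le (derivIndex_le r ν)] at h1
    have h3 := hermiteWeight_mul τ r ν
    refine mul_left_cancel₀ (multiFactorial_pos (ν - derivIndex r ν)).ne' ?_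
    rw [← mul_assoc, mul_comm _ (hermiteWeight τ r ν), h3, mul_assoc, ← h1]
    ring
  let idx : (ℕ →₀ ℕ) → {α : ℕ →₀ ℕ // ∀ j, α j ≤ r} := fun ν => ⟨derivIndex r ν, hidx ν⟩
  refine summable_of_sum_le (c := ∑' α : {α : ℕ →₀ ℕ // ∀ j, α j ≤ r},
    q α.1 * (eLpNorm (D α.1) 2 gaussMeasure).toReal ^ 2) (fun ν => ?_) fun S => ?_
  · rw [hterm]
    exact mul_nonneg (hq0 _) (sq_nonneg _)
  · rw [← Finset.sum_fiberwise_of_maps_to (g := idx) (t := S.image idx)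
      fun ν hν => Finset.mem_image_of_mem _ hν]
    refine le_trans (Finset.sum_le_sum fun α _ => ?_)
      (hsum.sum_le_tsum _ fun α _ => mul_nonneg (hq0 _) (sq_nonneg _))
    have hfib : ∀ ν ∈ S.filter (fun ν => idx ν = α), derivIndex r ν = α.1 := fun ν hν =>
      congrArg Subtype.val (Finset.mem_filter.1 hν).2
    have hrew : ∑ ν ∈ S.filter (fun ν => idx ν = α), hermiteWeight τ r ν * ‖hermiteCoeff F ν‖ ^ 2 =
        q α.1 * ∑ ν ∈ S.filter (fun ν => idx ν = α), ‖hermiteCoeff (D α.1) (ν - α.1)‖ ^ 2 := by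
      rw [Finset.mul_sum]
      exact Finset.sum_congr rfl fun ν hν => by rw [hterm, hfib ν hν]
    rw [hrew]
    refine mul_le_mul_of_nonneg_left ?_ (hq0 _)
    have hinj : Set.InjOn (fun ν : ℕ →₀ ℕ => ν - α.1)
        (S.filter fun ν => idx ν = α : Finset (ℕ →₀ ℕ)) := by
      intro ν hν κ hκ h
      have h1 : α.1 ≤ ν := (hfib ν hν) ▸ derivIndex_le r ν
      have h2 : α.1 ≤ κ := (hfib κ hκ) ▸ derivIndex_le r κ
      have h3 : ν - α.1 = κ - α.1 := h
      rw [← tsub_add_cancel_of_le h1, h3, tsub_add_cancel_of_le h2]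
    rw [← Finset.sum_image (g := fun ν : ℕ →₀ ℕ => ν - α.1)
      (f := fun κ => ‖hermiteCoeff (D α.1) κ‖ ^ 2) hinj]
    exact sum_norm_hermiteCoeff_sq_le (h2 α.1 α.2) _

end SparseCollocation

namespace SparseCollocation

/-! ### Decay of the majorants -/

theorem sum_finsupp_prod {R : Type*} [CommSemiring R] (s : Finset ℕ) (t : ℕ → Finset ℕ)
    (w : ℕ → ℕ → R) :
    ∑ ν ∈ s.finsupp t, ∏ m ∈ s, w m (ν m) = ∏ m ∈ s, ∑ n ∈ t m, w m n := by
  classical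
  rw [Finset.prod_sum, Finset.finsupp, Finset.sum_map]
  refine Finset.sum_congr (by congr!) fun q _ => ?_
  rw [← Finset.prod_attach s]
  refine Finset.prod_congr rfl fun m _ => ?_
  simp [Finsupp.indicator_of_mem m.2]

/-- Enlarge a finite set of multi-indices to a box, where the sum factorizes, and use `∏ (1 + b_m) ≤
exp (∑ b_m)`. -/
theorem summable_finsupp_prod {w : ℕ → ℕ → ℝ} (hw0 : ∀ m n, 0 ≤ w m n) (hw1 : ∀ m, w m 0 = 1)
    {b : ℕ → ℝ} (hb : Summable b) (hwb : ∀ m (T : Finset ℕ), ∑ n ∈ T, w m n ≤ 1 + b m) :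
    Summable fun ν : ℕ →₀ ℕ => ν.prod w := by
  classical
  have hb0 : ∀ m, 0 ≤ b m := fun m => by
    have := hwb m {0}
    simp only [Finset.sum_singleton, hw1] at this
    linarith
  refine summable_of_sum_le (c := Real.exp (∑' m, b m))
    (fun ν => Finset.prod_nonneg fun m _ => hw0 _ _) fun S => ?_
  set s := S.sup Finsupp.support with hs
  set t : ℕ → Finset ℕ := fun m => S.image fun ν => ν m with ht
  have hsub : ∀ ν ∈ S, ν.support ⊆ s := fun ν hν => Finset.le_sup (f := Finsupp.support) hν
  have hS : S ⊆ s.finsupp t := fun ν hν =>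
    Finset.mem_finsupp_iff.2 ⟨hsub ν hν, fun m _ => Finset.mem_image_of_mem _ hν⟩
  calc ∑ ν ∈ S, ν.prod w = ∑ ν ∈ S, ∏ m ∈ s, w m (ν m) :=
        Finset.sum_congr rfl fun ν hν =>
          Finsupp.prod_of_support_subset _ (hsub ν hν) _ fun m _ => hw1 m
    _ ≤ ∑ ν ∈ s.finsupp t, ∏ m ∈ s, w m (ν m) :=
        Finset.sum_le_sum_of_subset_of_nonneg hS fun ν _ _ =>
          Finset.prod_nonneg fun m _ => hw0 _ _
    _ = ∏ m ∈ s, ∑ n ∈ t m, w m n := sum_finsupp_prod s t w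
    _ ≤ ∏ m ∈ s, Real.exp (b m) :=
        Finset.prod_le_prod (fun m _ => Finset.sum_nonneg fun n _ => hw0 _ _) fun m _ =>
          (hwb m _).trans (by rw [add_comm]; exact Real.add_one_le_exp _)
    _ = Real.exp (∑ m ∈ s, b m) := (Real.exp_sum _ _).symm
    _ ≤ _ := Real.exp_le_exp.2 (hb.sum_le_tsum _ fun m _ => hb0 m)

/-- For `n < r` the left side is bounded and one derivative supplies the factor `τ²`; for `n ≥ r`
the binomial coefficient grows like `n^r`. The maximum of `τ⁻¹` and `τ⁻¹ ^ r` compensates `τ` in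
both cases, and equals `τ⁻¹` once `τ ≥ 1`. -/
theorem one_add_pow_le_choose_mul {r n : ℕ} (hr : 1 ≤ r) (hn : 1 ≤ n) {τ : ℝ} (hτ : 0 < τ) :
    (1 + n : ℝ) ^ r ≤ ((2 * r : ℝ) ^ r * r.factorial) * (max τ⁻¹ (τ⁻¹ ^ r)) ^ 2 *
      ((n.choose (derivOrder r n) : ℝ) * τ ^ (2 * derivOrder r n)) := by
  have hr' : (1 : ℝ) ≤ r := by exact_mod_cast hr
  have hn' : (1 : ℝ) ≤ n := by exact_mod_cast hn
  have hf : (1 : ℝ) ≤ r.factorial := by exact_mod_cast Nat.one_le_iff_ne_zero.2 r.factorial_ne_zero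
  have hn0 : n ≠ 0 := by omega
  set M := max τ⁻¹ (τ⁻¹ ^ r) with hM
  have hMpos : 0 < M := lt_max_of_lt_left (inv_pos.2 hτ)
  by_cases hnr : n < r
  · have h1 : derivOrder r n = 1 := by simp [derivOrder, hn0, hnr]
    rw [h1, Nat.choose_one_right]
    have h2 : 1 ≤ M * τ := by
      calc (1 : ℝ) = τ⁻¹ * τ := (inv_mul_cancel₀ hτ.ne').symm
        _ ≤ M * τ := mul_le_mul_of_nonneg_right (le_max_left _ _) hτ.le
    have h3 : (1 + n : ℝ) ≤ 2 * r := by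
      have : (n : ℝ) + 1 ≤ r := by exact_mod_cast hnr
      linarith
    have h4 : (1 + n : ℝ) ^ r ≤ (2 * r : ℝ) ^ r := pow_le_pow_left₀ (by positivity) h3 r
    calc (1 + n : ℝ) ^ r ≤ (2 * r : ℝ) ^ r * 1 * 1 * 1 := by simpa using h4
      _ ≤ (2 * r : ℝ) ^ r * r.factorial * (M * τ) ^ 2 * n := by
        gcongr
        exact one_le_pow₀ h2
      _ = _ := by ring
  · have hrn : r ≤ n := not_lt.1 hnr
    have h1 : derivOrder r n = r := by simp [derivOrder, hn0, hnr]
    rw [h1]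
    have h2 : 1 ≤ (M * τ ^ r) ^ 2 := by
      refine one_le_pow₀ ?_
      calc (1 : ℝ) = τ⁻¹ ^ r * τ ^ r := by rw [← mul_pow, inv_mul_cancel₀ hτ.ne', one_pow]
        _ ≤ M * τ ^ r := mul_le_mul_of_nonneg_right (le_max_right _ _) (by positivity)
    have h3 : (1 + n : ℝ) ≤ 2 * r * (n + 1 - r : ℕ) := by
      have : n ≤ r * (n + 1 - r) := by
        obtain ⟨k, rfl⟩ := Nat.exists_eq_add_of_le hrn
        have : r + k + 1 - r = k + 1 := by omega
        rw [this]
        nlinarith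
      have h' : (n : ℝ) ≤ r * (n + 1 - r : ℕ) := by exact_mod_cast this
      linarith
    have h4 := Nat.pow_le_choose (α := ℝ) r n
    rw [div_le_iff₀ (by positivity)] at h4
    calc (1 + n : ℝ) ^ r ≤ (2 * r * (n + 1 - r : ℕ)) ^ r :=
          pow_le_pow_left₀ (by positivity) h3 r
      _ = (2 * r : ℝ) ^ r * ((n + 1 - r : ℕ) : ℝ) ^ r * 1 := by rw [mul_pow, mul_one]
      _ ≤ (2 * r : ℝ) ^ r * (n.choose r * r.factorial) * (M * τ ^ r) ^ 2 := by
        gcongr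
      _ = _ := by ring

/-- The univariate factor of the majorant: `1` for `n = 0` and `min(1, a) (1 + n)^{-s}` else. -/
def decayFactor (a : ℕ → ℝ) (s : ℝ) (m n : ℕ) : ℝ :=
  if n = 0 then 1 else min 1 (a m) * (1 + n : ℝ) ^ (-s)

theorem decayFactor_pos {a : ℕ → ℝ} (ha : ∀ m, 0 < a m) (s : ℝ) (m n : ℕ) :
    0 < decayFactor a s m n := by
  unfold decayFactor
  split_ifs
  · exact one_pos
  · exact mul_pos (lt_min one_pos (ha m)) (by positivity)

/-- The truncation `min 1 (a m)` matters only for the step from `0`, where it keeps later values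
below `1`. -/
theorem decayFactor_strictAnti {a : ℕ → ℝ} (ha : ∀ m, 0 < a m) {s : ℝ} (hs : 0 < s) (m : ℕ) :
    StrictAnti (decayFactor a s m) := by
  intro n k hnk
  have hk : k ≠ 0 := by omega
  have hmin : 0 < min 1 (a m) := lt_min one_pos (ha m)
  simp only [decayFactor, hk, if_false]
  split_ifs with hn
  · have h1 : (1 + k : ℝ) ^ (-s) < 1 := by
      refine Real.rpow_lt_one_of_one_lt_of_neg ?_ (neg_lt_zero.2 hs)
      have : (0 : ℝ) < k := by exact_mod_cast Nat.pos_of_ne_zero hk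
      linarith
    calc min 1 (a m) * (1 + k : ℝ) ^ (-s) ≤ 1 * (1 + k : ℝ) ^ (-s) :=
          mul_le_mul_of_nonneg_right (min_le_left _ _) (by positivity)
      _ < 1 := by rwa [one_mul]
  · refine mul_lt_mul_of_pos_left ?_ hmin
    refine Real.rpow_lt_rpow_of_neg (by positivity) ?_ (neg_lt_zero.2 hs)
    have : (n : ℝ) < k := by exact_mod_cast hnk
    linarith

theorem decay_strictAnti {a : ℕ → ℝ} (ha : ∀ m, 0 < a m) {s : ℝ} (hs : 0 < s)
    {ν κ : ℕ →₀ ℕ} (h : ν < κ) : κ.prod (decayFactor a s) < ν.prod (decayFactor a s) := by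
  rw [Finsupp.prod_of_support_subset ν (Finsupp.support_mono h.le) _ fun m _ => by
    simp [decayFactor], Finsupp.prod]
  refine Finset.prod_lt_prod (fun m _ => decayFactor_pos ha s m _)
    (fun m _ => (decayFactor_strictAnti ha hs m).antitone (h.le m)) ?_
  obtain ⟨m, hm⟩ : ∃ m, ν m < κ m := by
    by_contra! hcon
    exact h.not_ge hcon
  exact ⟨m, Finsupp.mem_support_iff.2 (by omega), decayFactor_strictAnti ha hs m hm⟩

/-- In one coordinate the `p`-th powers sum to at most `1 + a_m ^ p * Z`, where `Z = ∑ (1 +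
n)^(-sp)` is finite because `sp > 1`. -/
theorem summable_decay_rpow {a : ℕ → ℝ} (ha : ∀ m, 0 < a m) {s p : ℝ} (hp : 0 < p)
    (hsp : 1 < s * p) (hap : Summable fun m => a m ^ p) :
    Summable fun ν : ℕ →₀ ℕ => (ν.prod (decayFactor a s)) ^ p := by
  have hz : Summable fun n : ℕ => (1 + n : ℝ) ^ (-(s * p)) := by
    have h := (Real.summable_one_div_nat_add_rpow 1 (s * p)).2 hsp
    refine h.congr fun n => ?_
    rw [abs_of_nonneg (by positivity), Real.rpow_neg (by positivity), one_div, add_comm]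
  set Z := ∑' n : ℕ, (1 + n : ℝ) ^ (-(s * p)) with hZ
  have h := summable_finsupp_prod (w := fun m n => decayFactor a s m n ^ p)
    (fun m n => Real.rpow_nonneg (decayFactor_pos ha s m n).le _) (fun m => by simp [decayFactor])
    (b := fun m => a m ^ p * Z) (hap.mul_right _) fun m T => ?_
  · refine h.congr fun ν => ?_
    exact Real.finsetProd_rpow _ _ (fun m _ => (decayFactor_pos ha s m _).le) _
  · have hle : ∀ n, decayFactor a s m n ^ p ≤
        (if n = 0 then 1 else 0) + a m ^ p * (1 + n : ℝ) ^ (-(s * p)) := by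
      intro n
      have hnn : 0 ≤ a m ^ p * (1 + n : ℝ) ^ (-(s * p)) :=
        mul_nonneg (Real.rpow_nonneg (ha m).le _) (by positivity)
      unfold decayFactor
      split_ifs with hn
      · simpa using hnn
      · have hmin : 0 < min 1 (a m) := lt_min one_pos (ha m)
        rw [zero_add, Real.mul_rpow hmin.le (by positivity), ← Real.rpow_mul (by positivity),
          neg_mul]
        exact mul_le_mul_of_nonneg_right
          (Real.rpow_le_rpow hmin.le (min_le_right _ _) hp.le) (by positivity)
    refine (Finset.sum_le_sum fun n _ => hle n).trans ?_
    rw [Finset.sum_add_distrib, ← Finset.mul_sum]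
    refine add_le_add ?_ (mul_le_mul_of_nonneg_left (hz.sum_le_tsum _ fun n _ => by positivity)
      (Real.rpow_nonneg (ha m).le _))
    rw [Finset.sum_ite_eq']
    split_ifs <;> norm_num

theorem one_add_mul_rpow_le {K θ : ℝ} (hK : 1 ≤ K) (hθ : 0 ≤ θ) {r n : ℕ} (hr : 1 ≤ r)
    (hn : 1 ≤ n) {τ : ℝ} (hτ : 0 < τ) :
    (1 + K * n) ^ (θ + 1) ≤
      K ^ (θ + 1) * √((2 * r : ℝ) ^ r * r.factorial) * max τ⁻¹ (τ⁻¹ ^ r) *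
        (1 + n : ℝ) ^ (-((r : ℝ) / 2 - (θ + 1))) *
        √((n.choose (derivOrder r n) : ℝ) * τ ^ (2 * derivOrder r n)) := by
  have hn0 : (0 : ℝ) < 1 + n := by positivity
  have hMpos : 0 < max τ⁻¹ (τ⁻¹ ^ r) := lt_max_of_lt_left (inv_pos.2 hτ)
  have h1 := Real.sqrt_le_sqrt (one_add_pow_le_choose_mul hr hn hτ)
  rw [Real.sqrt_mul (by positivity), Real.sqrt_mul (by positivity), Real.sqrt_sq hMpos.le] at h1
  have h2 : √((1 + n : ℝ) ^ r) = (1 + n : ℝ) ^ ((r : ℝ) / 2) := by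
    rw [Real.sqrt_eq_rpow, ← Real.rpow_natCast, ← Real.rpow_mul hn0.le]
    congr 1
    ring
  have h3 : (1 + K * n) ^ (θ + 1) ≤ K ^ (θ + 1) * (1 + n : ℝ) ^ (θ + 1) := by
    rw [← Real.mul_rpow (by positivity) hn0.le]
    refine Real.rpow_le_rpow (by positivity) ?_ (by positivity)
    nlinarith [n.cast_nonneg (α := ℝ)]
  have h4 : (1 + n : ℝ) ^ (θ + 1) =
      (1 + n : ℝ) ^ (-((r : ℝ) / 2 - (θ + 1))) * (1 + n : ℝ) ^ ((r : ℝ) / 2) := by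
    rw [← Real.rpow_add hn0]
    congr 1
    ring
  rw [h2] at h1
  refine h3.trans ?_
  rw [h4]
  have hKn : 0 ≤ K ^ (θ + 1) * (1 + n : ℝ) ^ (-((r : ℝ) / 2 - (θ + 1))) := by positivity
  calc _ = K ^ (θ + 1) * (1 + n : ℝ) ^ (-((r : ℝ) / 2 - (θ + 1))) * (1 + n : ℝ) ^ ((r : ℝ) / 2) := by
        ring
    _ ≤ _ := mul_le_mul_of_nonneg_left h1 hKn
    _ = _ := by ring

theorem exists_decay_majorant {K θ p : ℝ} (hK : 1 ≤ K) (hθ : 0 ≤ θ) (hp : 0 < p) {r : ℕ}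
    (hr : 2 * (θ + 1) + 2 / p < r) {τ : ℕ → ℝ} (hτ : ∀ m, 0 < τ m)
    (hτp : Summable fun m => ((τ m)⁻¹) ^ p) :
    ∃ (g : (ℕ →₀ ℕ) → ℝ) (A : ℝ), 0 ≤ A ∧ (∀ ν, 0 < g ν) ∧ (∀ ν κ, ν < κ → g κ < g ν) ∧
      (Summable fun ν => g ν ^ p) ∧
      ∀ ν : ℕ →₀ ℕ, (ν.prod fun _ n => (1 + K * n) ^ (θ + 1)) ≤
        A * g ν * √(hermiteWeight τ r ν) := by
  classical
  have hr1 : 1 ≤ r := by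
    have : (0 : ℝ) < r := lt_trans (by positivity) hr
    exact_mod_cast this
  -- The power `r / 2` gained from smoothness minus the loss `θ + 1`; the lower bound on `r` says
  -- precisely that `s > 1 / p`.
  set s : ℝ := (r : ℝ) / 2 - (θ + 1) with hs
  have hsp : 1 < s * p := by
    have h1 : 1 / p < s := by
      rw [hs]
      have : 2 / p = 2 * (1 / p) := by ring
      linarith
    rwa [div_lt_iff₀ hp] at h1
  have hs0 : 0 < s := by
    by_contra h
    nlinarith [not_lt.1 h]
  set C : ℝ := K ^ (θ + 1) * √((2 * r : ℝ) ^ r * r.factorial) with hC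
  have hC0 : 0 < C := by positivity
  set a : ℕ → ℝ := fun m => C * max (τ m)⁻¹ ((τ m)⁻¹ ^ r) with ha
  have ha0 : ∀ m, 0 < a m := fun m => mul_pos hC0 (lt_max_of_lt_left (inv_pos.2 (hτ m)))
  have hsmall : ∀ ε : ℝ, 0 < ε → ∀ᶠ m in Filter.cofinite, (τ m)⁻¹ < ε := by
    intro ε hε
    have h1 := hτp.tendsto_cofinite_zero.eventually (gt_mem_nhds (Real.rpow_pos_of_pos hε p))
    filter_upwards [h1] with m hm
    exact (Real.rpow_lt_rpow_iff (inv_pos.2 (hτ m)).le hε.le hp).1 hm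
  have hae : ∀ᶠ m in Filter.cofinite, a m = C * (τ m)⁻¹ := by
    filter_upwards [hsmall 1 one_pos] with m hm
    simp only [ha]
    rw [max_eq_left]
    exact pow_le_of_le_one (inv_pos.2 (hτ m)).le hm.le (by omega)
  have hap : Summable fun m => a m ^ p := by
    refine (hτp.mul_left (C ^ p)).congr_cofinite ?_
    filter_upwards [hae] with m hm
    rw [hm, Real.mul_rpow hC0.le (inv_pos.2 (hτ m)).le]
  have ha1 : {m | 1 < a m}.Finite := by
    have : ∀ᶠ m in Filter.cofinite, ¬ 1 < a m := by
      filter_upwards [hae, hsmall C⁻¹ (inv_pos.2 hC0)] with m hm hm2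
      rw [hm, not_lt]
      calc C * (τ m)⁻¹ ≤ C * C⁻¹ := mul_le_mul_of_nonneg_left hm2.le hC0.le
        _ = 1 := mul_inv_cancel₀ hC0.ne'
    simpa [Filter.eventually_cofinite] using this
  -- Only finitely many `a m` exceed `1`, as `τ_m⁻¹ → 0`. What the truncation in `decayFactor`
  -- discards is therefore bounded by one finite product.
  set A : ℝ := ∏ m ∈ ha1.toFinset, max 1 (a m) with hA
  have hA0 : 0 ≤ A := Finset.prod_nonneg fun m _ => le_trans zero_le_one (le_max_left _ _)
  have hAle : ∀ S : Finset ℕ, ∏ m ∈ S, max 1 (a m) ≤ A := by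
    intro S
    calc ∏ m ∈ S, max 1 (a m) ≤ ∏ m ∈ S ∪ ha1.toFinset, max 1 (a m) :=
          Finset.prod_le_prod_of_subset_of_one_le Finset.subset_union_left
            (fun m _ => le_trans zero_le_one (le_max_left _ _)) fun m _ _ => le_max_left _ _
      _ = A := by
          symm
          refine Finset.prod_subset Finset.subset_union_right fun m _ hm => ?_
          simp only [Set.Finite.mem_toFinset, Set.mem_ofPred_eq, not_lt] at hm
          exact max_eq_left hm
  refine ⟨fun ν => ν.prod (decayFactor a s), A, hA0,
    fun ν => Finset.prod_pos fun m _ => decayFactor_pos ha0 s m _,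
    fun ν κ h => decay_strictAnti ha0 hs0 h, summable_decay_rpow ha0 hp hsp hap, fun ν => ?_⟩
  have hw0 : ∀ m n : ℕ, 0 ≤ (n.choose (derivOrder r n) : ℝ) * τ m ^ (2 * derivOrder r n) :=
    fun m n => mul_nonneg (Nat.cast_nonneg _) (pow_nonneg (hτ m).le _)
  have hg0 : 0 ≤ ν.prod (decayFactor a s) :=
    Finset.prod_nonneg fun m _ => (decayFactor_pos ha0 s m _).le
  calc (ν.prod fun _ n => (1 + K * n) ^ (θ + 1))
      ≤ ∏ m ∈ ν.support, max 1 (a m) * decayFactor a s m (ν m) *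
          √((((ν m).choose (derivOrder r (ν m)) : ℕ) : ℝ) * τ m ^ (2 * derivOrder r (ν m))) := by
        refine Finset.prod_le_prod (fun m _ => by positivity) fun m hm => ?_
        have hm0 : ν m ≠ 0 := Finsupp.mem_support_iff.1 hm
        refine (one_add_mul_rpow_le hK hθ hr1 (Nat.one_le_iff_ne_zero.2 hm0) (hτ m)).trans
          (le_of_eq ?_)
        simp only [decayFactor, hm0, if_false]
        rw [← mul_assoc (max 1 (a m)), max_mul_min, one_mul]
    _ = (∏ m ∈ ν.support, max 1 (a m)) * ν.prod (decayFactor a s) * √(hermiteWeight τ r ν) := by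
        rw [Finset.prod_mul_distrib, Finset.prod_mul_distrib, hermiteWeight, Finsupp.prod,
          Finsupp.prod, Real.sqrt_prod _ fun m _ => hw0 m _]
    _ ≤ _ := by
        gcongr
        exact hAle _

/-! ### Nested index sets of the largest majorants -/

/-- Greedy selection of the largest remaining value gives nested sets, monotone because `g` strictly
decreases. The tail bound is Stechkin's: write `g² = g^p g^(2-p)` and bound the second factor
uniformly outside `Λ_N`. -/
theorem exists_nested_sets {p : ℝ} (hp : 0 < p) (hp2 : p < 2) {g : (ℕ →₀ ℕ) → ℝ}
    (hg0 : ∀ ν, 0 < g ν) (hanti : ∀ ν κ, ν < κ → g κ < g ν) (hsum : Summable fun ν => g ν ^ p) :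
    ∃ Λ : ℕ → Finset (ℕ →₀ ℕ), (∀ M N, M ≤ N → Λ M ⊆ Λ N) ∧
      (∀ N, IsLowerSet (Λ N : Set (ℕ →₀ ℕ))) ∧ (∀ N, (Λ N).card = N) ∧
      ∃ C : ℝ, 0 ≤ C ∧ ∀ (N : ℕ) (S : Finset (ℕ →₀ ℕ)), Disjoint S (Λ N) →
        ∑ ν ∈ S, g ν ^ 2 ≤ C * (1 + (N : ℝ)) ^ (-(2 / p - 1)) := by
  classical
  have hpick : ∀ Λ : Finset (ℕ →₀ ℕ), ∃ ν, ν ∉ Λ ∧ ∀ κ, κ ∉ Λ → g κ ≤ g ν := by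
    intro Λ
    obtain ⟨ν₀, hν₀⟩ := Λ.exists_notMem
    -- Summability makes `g ^ p` tend to zero, so only finitely many indices compete and a maximum
    -- is attained.
    have hfin : {ν | ν ∉ Λ ∧ g ν₀ ≤ g ν}.Finite := by
      have h1 := hsum.tendsto_cofinite_zero.eventually
        (gt_mem_nhds (Real.rpow_pos_of_pos (hg0 ν₀) p))
      rw [Filter.eventually_cofinite] at h1
      refine h1.subset fun ν hν => ?_
      simp only [Set.mem_ofPred_eq, not_lt]
      exact Real.rpow_le_rpow (hg0 _).le hν.2 hp.le
    obtain ⟨ν, hν, hmax⟩ := hfin.toFinset.exists_max_image g ⟨ν₀, by simp [hν₀]⟩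
    simp only [Set.Finite.mem_toFinset, Set.mem_ofPred_eq] at hν hmax
    refine ⟨ν, hν.1, fun κ hκ => ?_⟩
    by_cases h : g ν₀ ≤ g κ
    · exact hmax κ ⟨hκ, h⟩
    · exact (not_le.1 h).le.trans hν.2
  choose pick hpick1 hpick2 using hpick
  let Λ : ℕ → Finset (ℕ →₀ ℕ) := fun N => Nat.rec ∅ (fun _ Λ => insert (pick Λ) Λ) N
  have hsucc : ∀ N, Λ (N + 1) = insert (pick (Λ N)) (Λ N) := fun N => rfl
  have hcard : ∀ N, (Λ N).card = N := by
    intro N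
    induction N with
    | zero => rfl
    | succ N ih => rw [hsucc, Finset.card_insert_of_notMem (hpick1 _), ih]
  have hbest : ∀ N, ∀ ν ∈ Λ N, ∀ κ, κ ∉ Λ N → g κ ≤ g ν := by
    intro N
    induction N with
    | zero => exact fun ν hν => absurd hν (Finset.notMem_empty ν)
    | succ N ih =>
      intro ν hν κ hκ
      rw [hsucc] at hν hκ
      have hκ' : κ ∉ Λ N := fun h => hκ (Finset.mem_insert_of_mem h)
      rcases Finset.mem_insert.1 hν with rfl | hν
      · exact hpick2 _ κ hκ'
      · exact ih ν hν κ hκ'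
  set T := ∑' ν, g ν ^ p with hT
  have hgp : ∀ ν, 0 ≤ g ν ^ p := fun ν => Real.rpow_nonneg (hg0 ν).le _
  have hT0 : 0 ≤ T := tsum_nonneg hgp
  refine ⟨Λ, fun M N h => monotone_nat_of_le_succ (fun n => by
      rw [hsucc]; exact Finset.subset_insert _ _) h, fun N ν κ hκν hν => ?_, hcard,
    T * T ^ ((2 - p) / p), mul_nonneg hT0 (Real.rpow_nonneg hT0 _), fun N S hS => ?_⟩
  · by_contra hκ
    rcases hκν.eq_or_lt with rfl | hlt
    · exact hκ hν
    · exact absurd (hbest N ν hν κ hκ) (not_le.2 (hanti κ ν hlt))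
  · have hN : (0 : ℝ) < 1 + N := by positivity
    have hbound : ∀ κ, κ ∉ Λ N → g κ ≤ (T / (1 + N)) ^ (1 / p) := by
      intro κ hκ
      -- Adding `κ` itself to `Λ N` gives `N + 1` terms that are at least `g κ ^ p`; this is why the
      -- rate is in `1 + N` and holds at `N = 0`.
      have h1 : (1 + N : ℝ) * g κ ^ p ≤ T := by
        have h2 : ∑ ν ∈ insert κ (Λ N), g κ ^ p ≤ ∑ ν ∈ insert κ (Λ N), g ν ^ p := by
          refine Finset.sum_le_sum fun ν hν => ?_
          rcases Finset.mem_insert.1 hν with rfl | hν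
          · exact le_rfl
          · exact Real.rpow_le_rpow (hg0 _).le (hbest N ν hν κ hκ) hp.le
        rw [Finset.sum_const, Finset.card_insert_of_notMem hκ, hcard, nsmul_eq_mul] at h2
        push_cast at h2
        rw [add_comm (1 : ℝ)]
        exact h2.trans (hsum.sum_le_tsum _ fun ν _ => hgp ν)
      have h3 : g κ ^ p ≤ T / (1 + N) := by rwa [le_div_iff₀' hN]
      calc g κ = (g κ ^ p) ^ (1 / p) := by
            rw [← Real.rpow_mul (hg0 κ).le, mul_one_div_cancel hp.ne', Real.rpow_one]
        _ ≤ _ := Real.rpow_le_rpow (hgp κ) h3 (by positivity)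
    have h2p : 0 ≤ 2 - p := by linarith
    have hterm : ∀ κ, κ ∉ Λ N → g κ ^ 2 ≤ g κ ^ p * (T / (1 + N)) ^ ((2 - p) / p) := by
      intro κ hκ
      have h1 : g κ ^ 2 = g κ ^ p * g κ ^ (2 - p) := by
        rw [← Real.rpow_add (hg0 κ), ← Real.rpow_natCast]
        congr 1
        push_cast
        ring
      rw [h1]
      refine mul_le_mul_of_nonneg_left ?_ (hgp κ)
      refine (Real.rpow_le_rpow (hg0 κ).le (hbound κ hκ) h2p).trans (le_of_eq ?_)
      rw [← Real.rpow_mul (by positivity)]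
      congr 1
      ring
    calc ∑ ν ∈ S, g ν ^ 2 ≤ ∑ ν ∈ S, g ν ^ p * (T / (1 + N)) ^ ((2 - p) / p) :=
          Finset.sum_le_sum fun ν hν => hterm ν (Finset.disjoint_left.1 hS hν)
      _ = (∑ ν ∈ S, g ν ^ p) * (T / (1 + N)) ^ ((2 - p) / p) := (Finset.sum_mul _ _ _).symm
      _ ≤ T * (T / (1 + N)) ^ ((2 - p) / p) :=
          mul_le_mul_of_nonneg_right (hsum.sum_le_tsum _ fun ν _ => hgp ν) (by positivity)
      _ = _ := by
          rw [Real.div_rpow hT0 hN.le, Real.rpow_neg hN.le, div_eq_mul_inv, mul_assoc]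
          congr 4
          field_simp

end SparseCollocation

namespace SparseCollocation

/-! ### Univariate interpolation of Hermite polynomials -/

theorem hermitePoly_coeff_self (n : ℕ) : (hermitePoly n).coeff n ≠ 0 := by
  rw [hermitePoly, Polynomial.coeff_C_mul, Polynomial.coeff_map, Polynomial.coeff_hermite_self]
  simpa using (Nat.factorial_ne_zero n)

theorem exists_hermite_expansion (k : ℕ) (q : Polynomial ℝ) (hq : q.natDegree ≤ k) :
    ∃ c : ℕ → ℝ, ∀ t, q.eval t = ∑ j ∈ Finset.range (k + 1), c j * hermiteFun j t := by
  induction k generalizing q with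
  | zero =>
    refine ⟨fun _ => q.coeff 0, fun t => ?_⟩
    rw [Polynomial.eq_C_of_natDegree_le_zero hq]
    simp [hermiteFun_zero]
  | succ k ih =>
    set a := q.coeff (k + 1) / (hermitePoly (k + 1)).coeff (k + 1) with ha
    have hdeg : (q - Polynomial.C a * hermitePoly (k + 1)).natDegree ≤ k := by
      rw [Polynomial.natDegree_le_iff_coeff_eq_zero]
      intro N hN
      rw [Polynomial.coeff_sub, Polynomial.coeff_C_mul]
      rcases Nat.lt_or_ge (k + 1) N with h | h
      · rw [Polynomial.coeff_eq_zero_of_natDegree_lt (hq.trans_lt h),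
          Polynomial.coeff_eq_zero_of_degree_lt
            ((degree_hermitePoly_le (k + 1)).trans_lt (by exact_mod_cast h)), mul_zero, sub_zero]
      · obtain rfl : N = k + 1 := by omega
        rw [ha, div_mul_cancel₀ _ (hermitePoly_coeff_self _), sub_self]
    obtain ⟨c, hc⟩ := ih _ hdeg
    refine ⟨Function.update c (k + 1) a, fun t => ?_⟩
    have h1 := hc t
    rw [Polynomial.eval_sub, Polynomial.eval_mul, Polynomial.eval_C, eval_hermitePoly,
      sub_eq_iff_eq_add] at h1
    rw [Finset.sum_range_succ, Function.update_self, h1]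
    congr 1
    refine Finset.sum_congr rfl fun j hj => ?_
    rw [Function.update_of_ne (Finset.mem_range.1 hj).ne]

theorem integral_hermite_sum_sq (S : Finset ℕ) (c : ℕ → ℝ) :
    ∫ t, (∑ j ∈ S, c j * hermiteFun j t) ^ 2 ∂(gaussianReal 0 1) = ∑ j ∈ S, c j ^ 2 := by
  have h1 : ∀ t, (∑ j ∈ S, c j * hermiteFun j t) ^ 2 =
      ∑ i ∈ S, ∑ j ∈ S, c i * c j * (hermiteFun i t * hermiteFun j t) := by
    intro t
    rw [sq, Finset.sum_mul_sum]
    exact Finset.sum_congr rfl fun i _ => Finset.sum_congr rfl fun j _ => by ring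
  have hint : ∀ i j, Integrable (fun t => c i * c j * (hermiteFun i t * hermiteFun j t))
      (gaussianReal 0 1) := fun i j =>
    ((memLp_hermiteFun i).integrable_mul (memLp_hermiteFun j)).const_mul _
  simp only [h1]
  rw [integral_finsetSum _ fun i _ => integrable_finsetSum _ fun j _ => hint i j]
  refine Finset.sum_congr rfl fun i hi => ?_
  rw [integral_finsetSum _ fun j _ => hint i j]
  simp only [integral_const_mul, integral_hermiteFun_mul, mul_ite, mul_one, mul_zero]
  rw [Finset.sum_ite_eq, if_pos hi, sq]

/-- Point evaluation on polynomials of degree at most `k` is bounded in `L²(N(0,1))`. -/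
theorem exists_abs_eval_le (k : ℕ) (t : ℝ) : ∃ C : ℝ, ∀ q : Polynomial ℝ, q.natDegree ≤ k →
    |q.eval t| ≤ C * (eLpNorm (fun s => q.eval s) 2 (gaussianReal 0 1)).toReal := by
  refine ⟨∑ j ∈ Finset.range (k + 1), |hermiteFun j t|, fun q hq => ?_⟩
  obtain ⟨c, hc⟩ := exists_hermite_expansion k q hq
  set B := (eLpNorm (fun s => q.eval s) 2 (gaussianReal 0 1)).toReal with hB
  have hB2 : B ^ 2 = ∑ j ∈ Finset.range (k + 1), c j ^ 2 := by
    rw [← integral_hermite_sum_sq]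
    simp only [← hc]
    rw [hB, MemLp.eLpNorm_eq_integral_rpow_norm two_ne_zero ENNReal.ofNat_ne_top
      (memLp_polynomial q), ENNReal.toReal_ofReal (by positivity)]
    simp only [ENNReal.toReal_ofNat, Real.rpow_two, Real.norm_eq_abs, sq_abs]
    rw [← one_div, ← Real.sqrt_eq_rpow, Real.sq_sqrt (integral_nonneg fun t => sq_nonneg _)]
  have hcB : ∀ j ∈ Finset.range (k + 1), |c j| ≤ B := fun j hj => by
    refine abs_le_of_sq_le_sq (hB2 ▸ ?_) ENNReal.toReal_nonneg
    exact Finset.single_le_sum (f := fun j => c j ^ 2) (fun j _ => sq_nonneg _) hj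
  rw [hc, Finset.sum_mul]
  refine (Finset.abs_sum_le_sum_abs _ _).trans (Finset.sum_le_sum fun j hj => ?_)
  rw [abs_mul, mul_comm]
  exact mul_le_mul_of_nonneg_left (hcB j hj) (abs_nonneg _)

section Interpolation

variable {x : ℕ → ℕ → ℝ}

theorem injOn_range (hx : ∀ k, Set.InjOn (x k) (Set.Iic k)) (k : ℕ) :
    Set.InjOn (x k) (Finset.range (k + 1) : Finset ℕ) :=
  (hx k).mono fun _ hi => Nat.lt_succ_iff.1 (Finset.mem_range.1 hi)

theorem interp_eq_eval (k : ℕ) (g : ℝ → ℝ) (t : ℝ) :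
    interp x k g t = (Lagrange.interpolate (Finset.range (k + 1)) (x k)
      fun i => g (x k i)).eval t := by
  simp [interp, lagrangeFun, Lagrange.interpolate_apply, Polynomial.eval_finsetSum]

theorem interp_hermiteFun (hx : ∀ k, Set.InjOn (x k) (Set.Iic k)) {n k : ℕ} (h : n ≤ k) :
    interp x k (hermiteFun n) = hermiteFun n := by
  funext t
  rw [interp_eq_eval, ← eval_hermitePoly n t]
  congr 1
  simp only [← eval_hermitePoly]
  refine (Lagrange.eq_interpolate (injOn_range hx k) ?_).symm
  refine (degree_hermitePoly_le n).trans_lt ?_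
  rw [Finset.card_range]
  exact_mod_cast Nat.lt_succ_of_le h

theorem interp_apply_node (hx : ∀ k, Set.InjOn (x k) (Set.Iic k)) {k i : ℕ} (hi : i ≤ k)
    (g : ℝ → ℝ) : interp x k g (x k i) = g (x k i) := by
  rw [interp_eq_eval]
  exact Lagrange.eval_interpolate_at_node _ (injOn_range hx k)
    (Finset.mem_range.2 (Nat.lt_succ_of_le hi))

theorem natDegree_interpolate_le (hx : ∀ k, Set.InjOn (x k) (Set.Iic k)) (k : ℕ) (v : ℕ → ℝ) :
    (Lagrange.interpolate (Finset.range (k + 1)) (x k) v).natDegree ≤ k := by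
  have h := Lagrange.degree_interpolate_le (r := v) (injOn_range hx k)
  rw [Finset.card_range, Nat.add_sub_cancel] at h
  exact Polynomial.natDegree_le_of_degree_le h

theorem detail_hermiteFun_eq_zero (hx : ∀ k, Set.InjOn (x k) (Set.Iic k)) {n k : ℕ} (h : n < k)
    (t : ℝ) : detail x k (hermiteFun n) t = 0 := by
  cases k with
  | zero => omega
  | succ k =>
    rw [detail, interp_hermiteFun hx h.le, interp_hermiteFun hx (Nat.lt_succ_iff.1 h), sub_self]

theorem sum_detail (k : ℕ) (g : ℝ → ℝ) (t : ℝ) :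
    ∑ i ∈ Finset.range (k + 1), detail x i g t = interp x k g t := by
  induction k with
  | zero => simp [detail]
  | succ k ih =>
    rw [Finset.sum_range_succ, ih, detail]
    ring

theorem continuous_interp (k : ℕ) (g : ℝ → ℝ) : Continuous (interp x k g) := by
  have : interp x k g = fun t => (Lagrange.interpolate (Finset.range (k + 1)) (x k)
      fun i => g (x k i)).eval t := funext fun t => interp_eq_eval k g t
  rw [this]
  exact Polynomial.continuous _

theorem continuous_detail (k : ℕ) (g : ℝ → ℝ) : Continuous (detail x k g) := by
  cases k with
  | zero => exact continuous_interp 0 g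
  | succ k => exact (continuous_interp (k + 1) g).sub (continuous_interp k g)

theorem lagrangeFun_zero (i : ℕ) (hi : i ≤ 0) (t : ℝ) : lagrangeFun x 0 i t = 1 := by
  obtain rfl : i = 0 := by omega
  simp [lagrangeFun]

theorem interp_zero (g : ℝ → ℝ) : interp x 0 g = fun _ => g (x 0 0) := by
  funext t
  simp [interp, lagrangeFun_zero]

/-- Bounds on the point values of Hermite polynomials at the nodes; at level zero the constant
is `1`. -/
theorem exists_abs_hermiteFun_node_le (hx : ∀ k, Set.InjOn (x k) (Set.Iic k)) {θ K : ℝ}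
    (hK : 1 ≤ K)
    (hdetail : ∀ i ν : ℕ, eLpNorm (detail x i (hermiteFun ν)) 2 (gaussianReal 0 1)
        ≤ ENNReal.ofReal ((1 + K * ν) ^ θ)) :
    ∃ C : ℕ → ℝ, (∀ k, 1 ≤ C k) ∧ C 0 = 1 ∧ ∀ k i n : ℕ, i ≤ k →
      |hermiteFun n (x k i)| ≤ C k * (1 + K * n) ^ θ := by
  have hpos : ∀ n : ℕ, 0 ≤ (1 + K * n) ^ θ := fun n => Real.rpow_nonneg (by positivity) _
  have hzero : ∀ n : ℕ, |hermiteFun n (x 0 0)| ≤ (1 + K * n) ^ θ := by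
    intro n
    have h := hdetail 0 n
    have h1 : detail x 0 (hermiteFun n) = fun _ => hermiteFun n (x 0 0) := interp_zero _
    rw [h1, eLpNorm_const _ two_ne_zero (IsProbabilityMeasure.ne_zero _), measure_univ,
      ENNReal.one_rpow, mul_one] at h
    rw [← Real.norm_eq_abs]
    exact (ENNReal.ofReal_le_ofReal_iff (hpos n)).1 ((ofReal_norm _).trans_le h)
  have hk : ∀ k, ∃ C : ℝ, 1 ≤ C ∧ ∀ i n : ℕ, i ≤ k →
      |hermiteFun n (x k i)| ≤ C * (1 + K * n) ^ θ := by
    intro k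
    choose c hc using fun i => exists_abs_eval_le k (x k i)
    refine ⟨max 1 (∑ i ∈ Finset.range (k + 1), |c i| * (k + 1)), le_max_left _ _,
      fun i n hi => ?_⟩
    -- The interpolant is a sum of `k + 1` details and agrees with `H_n` at the nodes, so its norm
    -- controls the point values.
    have hnorm : (eLpNorm (interp x k (hermiteFun n)) 2 (gaussianReal 0 1)).toReal ≤
        (k + 1) * (1 + K * n) ^ θ := by
      refine ENNReal.toReal_le_of_le_ofReal (mul_nonneg (by positivity) (hpos n)) ?_
      have h1 : interp x k (hermiteFun n) =
          ∑ i ∈ Finset.range (k + 1), detail x i (hermiteFun n) := by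
        funext t
        rw [Finset.sum_apply, sum_detail]
      rw [h1]
      refine (eLpNorm_sum_le (fun i _ => (continuous_detail i _).aestronglyMeasurable)
        one_le_two).trans ?_
      refine (Finset.sum_le_sum fun i _ => hdetail i n).trans (le_of_eq ?_)
      rw [Finset.sum_const, Finset.card_range, nsmul_eq_mul, ENNReal.ofReal_mul (by positivity)]
      congr 1
      rw [ENNReal.ofReal_add (by positivity) zero_le_one]
      simp
    have h2 := hc i _ (natDegree_interpolate_le hx k fun i => hermiteFun n (x k i))
    simp only [← interp_eq_eval] at h2
    rw [interp_apply_node hx hi] at h2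
    refine h2.trans ?_
    calc _ ≤ |c i| * ((k + 1) * (1 + K * n) ^ θ) :=
          mul_le_mul (le_abs_self _) hnorm ENNReal.toReal_nonneg (abs_nonneg _)
      _ = (|c i| * (k + 1)) * (1 + K * n) ^ θ := by ring
      _ ≤ _ := by
          refine mul_le_mul_of_nonneg_right (le_trans ?_ (le_max_right _ _)) (hpos n)
          exact Finset.single_le_sum (f := fun i => |c i| * ((k : ℝ) + 1))
            (fun i _ => by positivity) (Finset.mem_range.2 (Nat.lt_succ_of_le hi))
  choose C hC1 hC2 using hk
  -- Constant `1` at level zero is essential: all but finitely many coordinates have level zero, and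
  -- a larger constant there would make the product grow with the support of `ν`.
  refine ⟨fun k => if k = 0 then 1 else C k, fun k => ?_, by simp, fun k i n hi => ?_⟩
  · dsimp only
    split_ifs
    · exact le_rfl
    · exact hC1 k
  · dsimp only
    split_ifs with h
    · subst h
      obtain rfl : i = 0 := by omega
      rw [one_mul]
      exact hzero n
    · exact hC2 k i n hi

theorem exists_abs_hermiteMulti_node_le (hx : ∀ k, Set.InjOn (x k) (Set.Iic k)) {θ K : ℝ}
    (hK : 1 ≤ K)
    (hdetail : ∀ i ν : ℕ, eLpNorm (detail x i (hermiteFun ν)) 2 (gaussianReal 0 1)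
        ≤ ENNReal.ofReal ((1 + K * ν) ^ θ)) {k : ℕ →₀ ℕ} {y : ℕ → ℝ} (hy : y ∈ nodeGrid x k) :
    ∃ C : ℝ, ∀ ν, |hermiteMulti ν y| ≤ C * ν.prod fun _ n => (1 + K * n) ^ θ := by
  classical
  obtain ⟨C, hC1, hC0, hC⟩ := exists_abs_hermiteFun_node_le hx hK hdetail
  refine ⟨∏ m ∈ k.support, C (k m), fun ν => ?_⟩
  have hpos : ∀ n : ℕ, 0 ≤ (1 + K * n) ^ θ := fun n => Real.rpow_nonneg (by positivity) _
  have hCpos : ∀ k, 0 ≤ C k := fun k => zero_le_one.trans (hC1 k)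
  rw [hermiteMulti, Finsupp.prod, Finset.abs_prod]
  calc ∏ m ∈ ν.support, |hermiteFun (ν m) (y m)|
      ≤ ∏ m ∈ ν.support, C (k m) * (1 + K * ν m) ^ θ := by
        refine Finset.prod_le_prod (fun m _ => abs_nonneg _) fun m _ => ?_
        obtain ⟨i, hi, hyi⟩ := hy m
        rw [hyi]
        exact hC _ _ _ hi
    _ = (∏ m ∈ ν.support, C (k m)) * ∏ m ∈ ν.support, (1 + K * ν m) ^ θ :=
        Finset.prod_mul_distrib
    _ ≤ _ := by
        refine mul_le_mul_of_nonneg_right ?_ (Finset.prod_nonneg fun m _ => hpos _)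
        calc ∏ m ∈ ν.support, C (k m) ≤ ∏ m ∈ ν.support ∪ k.support, C (k m) :=
              Finset.prod_le_prod_of_subset_of_one_le Finset.subset_union_left
                (fun m _ => hCpos _) fun m _ _ => hC1 _
          _ = _ := by
              symm
              refine Finset.prod_subset Finset.subset_union_right fun m _ hm => ?_
              rw [Finsupp.notMem_support_iff.1 hm, hC0]

/-! ### Tensorized interpolation of Hermite polynomials -/

variable {Γ : Set (ℕ → ℝ)} (hΓ : ∀ k, nodeGrid x k ⊆ Γ)

theorem Icc_zero_eq_finsupp {k : ℕ →₀ ℕ} {s : Finset ℕ} (hs : k.support ⊆ s) :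
    Finset.Icc 0 k = s.finsupp fun m => Finset.range (k m + 1) := by
  ext i
  rw [Finset.mem_finsupp_iff, Finset.mem_Icc]
  constructor
  · rintro ⟨-, h⟩
    exact ⟨(Finsupp.support_mono h).trans hs, fun m _ =>
      Finset.mem_range.2 (Nat.lt_succ_of_le (h m))⟩
  · rintro ⟨h1, h2⟩
    refine ⟨zero_le, fun m => ?_⟩
    by_cases hm : m ∈ s
    · exact Nat.lt_succ_iff.1 (Finset.mem_range.1 (h2 m hm))
    · rw [Finsupp.notMem_support_iff.1 fun h => hm (h1 h)]
      exact Nat.zero_le _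

theorem tensorInterp_hermiteMulti {k ν : ℕ →₀ ℕ} {s : Finset ℕ} (hk : k.support ⊆ s)
    (hν : ν.support ⊆ s) (ξ : ℕ → ℝ) :
    tensorInterp x hΓ k (fun y => hermiteMulti ν y) ξ =
      ∏ m ∈ s, interp x (k m) (hermiteFun (ν m)) (ξ m) := by
  have h1 := sum_finsupp_prod s (fun m => Finset.range (k m + 1)) fun m i =>
    hermiteFun (ν m) (x (k m) i) * lagrangeFun x (k m) i (ξ m)
  rw [← Icc_zero_eq_finsupp hk] at h1
  unfold interp
  rw [← h1, tensorInterp, ← Finset.sum_coe_sort (Finset.Icc 0 k)]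
  refine Finset.sum_congr rfl fun i _ => ?_
  have hi : i.1 ≤ k := (Finset.mem_Icc.1 i.2).2
  rw [Finset.prod_mul_distrib, smul_eq_mul, mul_comm, hermiteMulti_eq_prod hν]
  congr 1
  refine Finset.prod_subset hk fun m _ hm => ?_
  have hkm := Finsupp.notMem_support_iff.1 hm
  rw [hkm]
  exact lagrangeFun_zero _ (hkm ▸ hi m) _

theorem sub_sum_single_apply (k : ℕ →₀ ℕ) (S : Finset ℕ) (j : ℕ) :
    (k - ∑ m ∈ S, Finsupp.single m 1 : ℕ →₀ ℕ) j = if j ∈ S then k j - 1 else k j := by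
  rw [Finsupp.tsub_apply, Finsupp.finsetSum_apply]
  simp only [Finsupp.single_apply, Finset.sum_ite_eq']
  split_ifs <;> rfl

/-- The alternating sum over `S` is the expanded product of differences over the support of `k`;
outside it, the detail of level zero is the interpolation itself. -/
theorem tensorDetail_hermiteMulti {k ν : ℕ →₀ ℕ} {s : Finset ℕ} (hk : k.support ⊆ s)
    (hν : ν.support ⊆ s) (ξ : ℕ → ℝ) :
    tensorDetail x hΓ k (fun y => hermiteMulti ν y) ξ =
      ∏ m ∈ s, detail x (k m) (hermiteFun (ν m)) (ξ m) := by
  classical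
  have hdet : ∀ m ∈ k.support, detail x (k m) (hermiteFun (ν m)) (ξ m) =
      interp x (k m) (hermiteFun (ν m)) (ξ m) - interp x (k m - 1) (hermiteFun (ν m)) (ξ m) := by
    intro m hm
    obtain ⟨j, hj⟩ := Nat.exists_eq_succ_of_ne_zero (Finsupp.mem_support_iff.1 hm)
    rw [hj]
    rfl
  rw [← Finset.prod_sdiff hk, Finset.prod_congr rfl hdet, Finset.prod_sub, tensorDetail,
    Finset.mul_sum]
  refine Finset.sum_congr rfl fun S hS => ?_
  have hSk := Finset.mem_powerset.1 hS
  rw [tensorInterp_hermiteMulti hΓ ((Finsupp.support_mono tsub_le_self).trans hk) hν,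
    smul_eq_mul, ← Finset.prod_sdiff hk, ← Finset.prod_sdiff hSk]
  simp only [sub_sum_single_apply]
  have e1 : ∀ m ∈ s \ k.support, interp x (if m ∈ S then k m - 1 else k m)
      (hermiteFun (ν m)) (ξ m) = detail x (k m) (hermiteFun (ν m)) (ξ m) := by
    intro m hm
    have hm' := (Finset.mem_sdiff.1 hm).2
    rw [if_neg fun h => hm' (hSk h), Finsupp.notMem_support_iff.1 hm']
    rfl
  have e2 : ∀ m ∈ k.support \ S, interp x (if m ∈ S then k m - 1 else k m)
      (hermiteFun (ν m)) (ξ m) = interp x (k m) (hermiteFun (ν m)) (ξ m) := fun m hm => by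
    rw [if_neg (Finset.mem_sdiff.1 hm).2]
  have e3 : ∀ m ∈ S, interp x (if m ∈ S then k m - 1 else k m)
      (hermiteFun (ν m)) (ξ m) = interp x (k m - 1) (hermiteFun (ν m)) (ξ m) := fun m hm => by
    rw [if_pos hm]
  rw [Finset.prod_congr rfl e1, Finset.prod_congr rfl e2, Finset.prod_congr rfl e3]
  ring

theorem tensorDetail_hermiteMulti_eq_zero (hx : ∀ k, Set.InjOn (x k) (Set.Iic k)) {k ν : ℕ →₀ ℕ}
    (h : ¬ k ≤ ν) (ξ : ℕ → ℝ) : tensorDetail x hΓ k (fun y => hermiteMulti ν y) ξ = 0 := by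
  classical
  rw [tensorDetail_hermiteMulti hΓ Finset.subset_union_left Finset.subset_union_right]
  obtain ⟨m, hm⟩ : ∃ m, ν m < k m := by
    by_contra! hcon
    exact h hcon
  exact Finset.prod_eq_zero (i := m) (Finset.mem_union_left _ (Finsupp.mem_support_iff.2 (by omega)))
    (detail_hermiteFun_eq_zero hx hm _)

/-- The sum over the box factorizes and telescopes in each coordinate to interpolation of level
`ν_m`, which is exact on degree `ν_m`. -/
theorem sum_tensorDetail_hermiteMulti (hx : ∀ k, Set.InjOn (x k) (Set.Iic k)) (ν : ℕ →₀ ℕ)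
    (ξ : ℕ → ℝ) :
    ∑ k ∈ Finset.Icc 0 ν, tensorDetail x hΓ k (fun y => hermiteMulti ν y) ξ =
      hermiteMulti ν ξ := by
  have h1 : ∀ k ∈ Finset.Icc 0 ν, tensorDetail x hΓ k (fun y => hermiteMulti ν y) ξ =
      ∏ m ∈ ν.support, detail x (k m) (hermiteFun (ν m)) (ξ m) := fun k hk =>
    tensorDetail_hermiteMulti hΓ (Finsupp.support_mono (Finset.mem_Icc.1 hk).2) subset_rfl ξ
  rw [Finset.sum_congr rfl h1, Icc_zero_eq_finsupp (k := ν) subset_rfl,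
    sum_finsupp_prod ν.support _ fun m i => detail x i (hermiteFun (ν m)) (ξ m)]
  simp only [sum_detail, interp_hermiteFun hx le_rfl]
  rfl

theorem hermiteMulti_sub_sparseCollocation (hx : ∀ k, Set.InjOn (x k) (Set.Iic k))
    (Λ : Finset (ℕ →₀ ℕ)) (ν : ℕ →₀ ℕ) (ξ : ℕ → ℝ) :
    hermiteMulti ν ξ - sparseCollocation x hΓ Λ (fun y => hermiteMulti ν y) ξ =
      ∑ k ∈ Finset.Icc 0 ν \ Λ, tensorDetail x hΓ k (fun y => hermiteMulti ν y) ξ := by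
  classical
  have h1 : sparseCollocation x hΓ Λ (fun y => hermiteMulti ν y) ξ =
      ∑ k ∈ Finset.Icc 0 ν ∩ Λ, tensorDetail x hΓ k (fun y => hermiteMulti ν y) ξ := by
    symm
    refine Finset.sum_subset Finset.inter_subset_right fun k hk hk' => ?_
    refine tensorDetail_hermiteMulti_eq_zero hΓ hx (fun h => hk' ?_) ξ
    exact Finset.mem_inter.2 ⟨Finset.mem_Icc.2 ⟨zero_le, h⟩, hk⟩
  rw [h1, ← sum_tensorDetail_hermiteMulti hΓ hx, sub_eq_iff_eq_add, add_comm,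
    Finset.sum_inter_add_sum_sdiff]

theorem hermiteMulti_sub_sparseCollocation_eq_zero (hx : ∀ k, Set.InjOn (x k) (Set.Iic k))
    {Λ : Finset (ℕ →₀ ℕ)} (hΛ : IsLowerSet (Λ : Set (ℕ →₀ ℕ))) {ν : ℕ →₀ ℕ} (hν : ν ∈ Λ)
    (ξ : ℕ → ℝ) :
    hermiteMulti ν ξ - sparseCollocation x hΓ Λ (fun y => hermiteMulti ν y) ξ = 0 := by
  rw [hermiteMulti_sub_sparseCollocation hΓ hx,
    Finset.sdiff_eq_empty_iff_subset.2 fun k hk => hΛ (Finset.mem_Icc.1 hk).2 hν,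
    Finset.sum_empty]

theorem eLpNorm_hermiteMulti_sub_sparseCollocation_le (hx : ∀ k, Set.InjOn (x k) (Set.Iic k))
    {θ K : ℝ} (hK : 1 ≤ K)
    (hdetail : ∀ i ν : ℕ, eLpNorm (detail x i (hermiteFun ν)) 2 (gaussianReal 0 1)
        ≤ ENNReal.ofReal ((1 + K * ν) ^ θ)) (Λ : Finset (ℕ →₀ ℕ)) (ν : ℕ →₀ ℕ) :
    (eLpNorm (fun ξ => hermiteMulti ν ξ -
      sparseCollocation x hΓ Λ (fun y => hermiteMulti ν y) ξ) 2 gaussMeasure).toReal ≤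
        ν.prod fun _ n => (1 + K * n) ^ (θ + 1) := by
  have hpos : ∀ n : ℕ, 0 < 1 + K * n := fun n => by positivity
  have hterm : ∀ k ∈ Finset.Icc 0 ν \ Λ,
      eLpNorm (tensorDetail x hΓ k fun y => hermiteMulti ν y) 2 gaussMeasure ≤
        ENNReal.ofReal (ν.prod fun _ n => (1 + K * n) ^ θ) := by
    intro k hk
    have h1 : (tensorDetail x hΓ k fun y => hermiteMulti ν y) = fun ξ =>
        ∏ m ∈ ν.support, detail x (k m) (hermiteFun (ν m)) (ξ m) := funext fun ξ =>
      tensorDetail_hermiteMulti hΓ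
        (Finsupp.support_mono (Finset.mem_Icc.1 (Finset.mem_sdiff.1 hk).1).2) subset_rfl ξ
    rw [h1, eLpNorm_prod_gaussMeasure _ (fun m t => detail x (k m) (hermiteFun (ν m)) t)
      fun m => (continuous_detail _ _).measurable, Finsupp.prod,
      ENNReal.ofReal_prod_of_nonneg fun m _ => Real.rpow_nonneg (hpos _).le _]
    exact Finset.prod_le_prod' fun m _ => hdetail _ _
  have hmeas : ∀ k ∈ Finset.Icc 0 ν \ Λ, AEStronglyMeasurable
      (tensorDetail x hΓ k fun y => hermiteMulti ν y) gaussMeasure := by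
    intro k hk
    have h1 : (tensorDetail x hΓ k fun y => hermiteMulti ν y) = fun ξ =>
        ∏ m ∈ ν.support, detail x (k m) (hermiteFun (ν m)) (ξ m) := funext fun ξ =>
      tensorDetail_hermiteMulti hΓ
        (Finsupp.support_mono (Finset.mem_Icc.1 (Finset.mem_sdiff.1 hk).1).2) subset_rfl ξ
    rw [h1]
    exact (Finset.measurable_fun_prod _ fun m _ =>
      (continuous_detail _ _).measurable.comp (measurable_pi_apply m)).aestronglyMeasurable
  have heq : (fun ξ => hermiteMulti ν ξ -
      sparseCollocation x hΓ Λ (fun y => hermiteMulti ν y) ξ) =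
        ∑ k ∈ Finset.Icc 0 ν \ Λ, tensorDetail x hΓ k fun y => hermiteMulti ν y := by
    funext ξ
    rw [hermiteMulti_sub_sparseCollocation hΓ hx, Finset.sum_apply]
  have hprod0 : 0 ≤ ν.prod fun _ n => (1 + K * n) ^ θ :=
    Finset.prod_nonneg fun m _ => Real.rpow_nonneg (hpos _).le _
  refine ENNReal.toReal_le_of_le_ofReal
    (Finset.prod_nonneg fun m _ => Real.rpow_nonneg (hpos _).le _) ?_
  rw [heq]
  refine (eLpNorm_sum_le hmeas one_le_two).trans ((Finset.sum_le_sum hterm).trans ?_)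
  rw [Finset.sum_const, nsmul_eq_mul, ← ENNReal.ofReal_natCast, ← ENNReal.ofReal_mul (by positivity)]
  refine ENNReal.ofReal_le_ofReal ?_
  -- Counting the box below `ν` costs one more power of `1 + K ν_m`, using `K ≥ 1`; hence the
  -- exponent `θ + 1`.
  have hcard : ((Finset.Icc 0 ν \ Λ).card : ℝ) ≤ ν.prod fun _ n => (1 + K * n) := by
    refine (Nat.cast_le.2 (Finset.card_le_card Finset.sdiff_subset)).trans ?_
    rw [Icc_zero_eq_finsupp (k := ν) subset_rfl, Finset.card_finsupp, Nat.cast_prod]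
    refine Finset.prod_le_prod (fun m _ => Nat.cast_nonneg _) fun m _ => ?_
    rw [Finset.card_range]
    push_cast
    nlinarith [(ν m).cast_nonneg (α := ℝ)]
  refine (mul_le_mul_of_nonneg_right hcard hprod0).trans (le_of_eq ?_)
  rw [Finsupp.prod, Finsupp.prod, Finsupp.prod, ← Finset.prod_mul_distrib]
  refine Finset.prod_congr rfl fun m _ => ?_
  rw [Real.rpow_add (hpos _), Real.rpow_one, mul_comm]

end Interpolation

end SparseCollocation

namespace SparseCollocation

/-! ### The collocation operator as a finite combination of point values -/

/-- The level `k - ∑_{m ∈ S} e_m` occurring in the expansion of `Δ_k`. -/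
abbrev lowerLevel (k : ℕ →₀ ℕ) (S : Finset ℕ) : ℕ →₀ ℕ := k - ∑ m ∈ S, Finsupp.single m 1

/-- The index set of the point evaluations in `U_Λ`. -/
abbrev NodeIndex (Λ : Finset (ℕ →₀ ℕ)) : Type :=
  (k : Λ) × (S : {S // S ∈ k.1.support.powerset}) ×
    {i : ℕ →₀ ℕ // i ∈ Finset.Icc 0 (lowerLevel k.1 S.1)}

/-- The function that multiplies the point value with index `j` in `U_Λ`. -/
def nodeWeight (x : ℕ → ℕ → ℝ) {Λ : Finset (ℕ →₀ ℕ)} (j : NodeIndex Λ) (ξ : ℕ → ℝ) : ℝ :=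
  (-1) ^ j.2.1.1.card * lagrangeMulti x (lowerLevel j.1.1 j.2.1.1) j.2.2.1 ξ

/-- The node with index `j` in `U_Λ`. -/
def nodePoint (x : ℕ → ℕ → ℝ) {Γ : Set (ℕ → ℝ)} (hΓ : ∀ k, nodeGrid x k ⊆ Γ)
    {Λ : Finset (ℕ →₀ ℕ)} (j : NodeIndex Λ) : Γ :=
  ⟨gridNode x (lowerLevel j.1.1 j.2.1.1) j.2.2.1,
    hΓ _ (gridNode_mem x (Finset.mem_Icc.1 j.2.2.2).2)⟩

theorem nodePoint_mem (x : ℕ → ℕ → ℝ) {Γ : Set (ℕ → ℝ)} (hΓ : ∀ k, nodeGrid x k ⊆ Γ)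
    {Λ : Finset (ℕ →₀ ℕ)} (j : NodeIndex Λ) :
    (nodePoint x hΓ j : ℕ → ℝ) ∈ nodeGrid x (lowerLevel j.1.1 j.2.1.1) :=
  gridNode_mem x (Finset.mem_Icc.1 j.2.2.2).2

theorem memLp_nodeWeight (x : ℕ → ℕ → ℝ) {Λ : Finset (ℕ →₀ ℕ)} (j : NodeIndex Λ) :
    MemLp (nodeWeight x j) 2 gaussMeasure :=
  (memLp_prod_gaussMeasure _
    (fun m => lagrangeFun x (lowerLevel j.1.1 j.2.1.1 m) (j.2.2.1 m))
    (fun _ => (Polynomial.continuous _).measurable) fun _ _ => memLp_polynomial _).const_mul _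

section

variable {H : Type*} [NormedAddCommGroup H] [InnerProductSpace ℝ H]
  {x : ℕ → ℕ → ℝ} {Γ : Set (ℕ → ℝ)} (hΓ : ∀ k, nodeGrid x k ⊆ Γ)

/-- As a finite combination of point values with `L²` weights, `U_Λ` passes through any series that
converges at the nodes. -/
theorem sparseCollocation_eq_sum (Λ : Finset (ℕ →₀ ℕ)) (f : Γ → H) (ξ : ℕ → ℝ) :
    sparseCollocation x hΓ Λ f ξ =
      ∑ j : NodeIndex Λ, nodeWeight x j ξ • f (nodePoint x hΓ j) := by
  rw [Fintype.sum_sigma, sparseCollocation, ← Finset.sum_coe_sort Λ]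
  refine Finset.sum_congr rfl fun k _ => ?_
  rw [Fintype.sum_sigma, tensorDetail, ← Finset.sum_coe_sort k.1.support.powerset]
  refine Finset.sum_congr rfl fun S _ => ?_
  rw [tensorInterp, Finset.smul_sum]
  refine Finset.sum_congr rfl fun i _ => ?_
  rw [smul_smul]
  rfl

theorem memLp_sparseCollocation (Λ : Finset (ℕ →₀ ℕ)) (f : Γ → H) :
    MemLp (sparseCollocation x hΓ Λ f) 2 gaussMeasure := by
  have h : sparseCollocation x hΓ Λ f =
      fun ξ => ∑ j : NodeIndex Λ, nodeWeight x j ξ • f (nodePoint x hΓ j) :=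
    funext fun ξ => sparseCollocation_eq_sum hΓ Λ f ξ
  rw [h]
  exact memLp_finsetSum _ fun j _ => memLp_smul_vec (memLp_nodeWeight x j) _

theorem toLp_sparseCollocation (Λ : Finset (ℕ →₀ ℕ)) (f : Γ → H) :
    (memLp_sparseCollocation hΓ Λ f).toLp _ =
      ∑ j : NodeIndex Λ, smulLp (nodeWeight x j) (memLp_nodeWeight x j) (f (nodePoint x hΓ j)) := by
  refine Lp.ext ?_
  have h2 : ∀ᵐ ξ ∂gaussMeasure, ∀ j : NodeIndex Λ,
      smulLp (nodeWeight x j) (memLp_nodeWeight x j) (f (nodePoint x hΓ j)) ξ =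
        nodeWeight x j ξ • f (nodePoint x hΓ j) :=
    ae_all_iff.2 fun j => coeFn_smulLp _ _
  filter_upwards [(memLp_sparseCollocation hΓ Λ f).coeFn_toLp, Lp.coeFn_fun_finsetSum Finset.univ
    fun j : NodeIndex Λ => smulLp (nodeWeight x j) (memLp_nodeWeight x j) (f (nodePoint x hΓ j)),
    h2] with ξ h1 h3 h2
  rw [h1, h3, sparseCollocation_eq_sum]
  exact Finset.sum_congr rfl fun j _ => (h2 j).symm

theorem memLp_hermiteMulti_sub_sparseCollocation (Λ : Finset (ℕ →₀ ℕ)) (ν : ℕ →₀ ℕ) :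
    MemLp (fun ξ => hermiteMulti ν ξ -
      sparseCollocation x hΓ Λ (fun y => hermiteMulti ν y) ξ) 2 gaussMeasure :=
  (memLp_hermiteMulti ν).sub (memLp_sparseCollocation hΓ Λ _)

theorem hermiteLp_sub_sum_eq (Λ : Finset (ℕ →₀ ℕ)) (ν : ℕ →₀ ℕ) (h : H) :
    hermiteLp ν h - ∑ j : NodeIndex Λ, smulLp (nodeWeight x j) (memLp_nodeWeight x j)
        (hermiteMulti ν (nodePoint x hΓ j) • h) =
      smulLp _ (memLp_hermiteMulti_sub_sparseCollocation hΓ Λ ν) h := by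
  rw [← toLp_sparseCollocation hΓ Λ fun y : Γ => hermiteMulti ν y • h, smulLp_apply, smulLp_apply,
    ← MemLp.toLp_sub]
  refine MemLp.toLp_congr _ _ (ae_of_all _ fun ξ => ?_)
  simp only [Pi.sub_apply, sparseCollocation_eq_sum, sub_smul, smul_smul, Finset.sum_smul,
    smul_eq_mul]

/-- Error of sparse collocation in terms of the Hermite coefficients. -/
theorem norm_toLp_sub_toLp_sparseCollocation_le [CompleteSpace H]
    [TopologicalSpace.SeparableSpace H] (hx : ∀ k, Set.InjOn (x k) (Set.Iic k)) {θ K : ℝ}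
    (hθ : 0 ≤ θ) (hK : 1 ≤ K)
    (hdetail : ∀ i ν : ℕ, eLpNorm (detail x i (hermiteFun ν)) 2 (gaussianReal 0 1)
        ≤ ENNReal.ofReal ((1 + K * ν) ^ θ))
    {f : Γ → H} {F : (ℕ → ℝ) → H} (hF2 : MemLp F 2 gaussMeasure)
    (hval : ∀ (k : ℕ →₀ ℕ) (ξ : Γ), (ξ : ℕ → ℝ) ∈ nodeGrid x k → ∀ s : H,
      HasSum (fun ν : ℕ →₀ ℕ => hermiteMulti ν ξ • hermiteCoeff F ν) s → f ξ = s)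
    (hsum : Summable fun ν : ℕ →₀ ℕ =>
      (ν.prod fun _ n => (1 + K * n) ^ (θ + 1)) * ‖hermiteCoeff F ν‖)
    {Λ : Finset (ℕ →₀ ℕ)} (hΛ : IsLowerSet (Λ : Set (ℕ →₀ ℕ))) {B : ℝ}
    (hB : ∀ S : Finset (ℕ →₀ ℕ), Disjoint S Λ →
      ∑ ν ∈ S, (ν.prod fun _ n => (1 + K * n) ^ (θ + 1)) * ‖hermiteCoeff F ν‖ ≤ B) :
    eLpNorm (fun ξ => F ξ - sparseCollocation x hΓ Λ f ξ) 2 gaussMeasure ≤ ENNReal.ofReal B := by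
  classical
  set c : (ℕ →₀ ℕ) → ℝ := fun ν => ν.prod fun _ n => (1 + K * n) ^ (θ + 1) with hc
  have hone : ∀ n : ℕ, 1 ≤ 1 + K * n := fun n => by
    have : 0 ≤ K * n := by positivity
    linarith
  have hc1 : ∀ ν, 1 ≤ c ν := fun ν => Finset.one_le_prod fun m _ =>
    Real.one_le_rpow (hone _) (by linarith)
  have hcθ : ∀ ν : ℕ →₀ ℕ, (ν.prod fun _ n => (1 + K * n) ^ θ) ≤ c ν := fun ν =>
    Finset.prod_le_prod (fun m _ => Real.rpow_nonneg (zero_le_one.trans (hone _)) _) fun m _ =>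
      Real.rpow_le_rpow_of_exponent_le (hone _) (by linarith)
  have hcoef : Summable fun ν => ‖hermiteCoeff F ν‖ :=
    hsum.of_nonneg_of_le (fun _ => norm_nonneg _) fun ν =>
      le_mul_of_one_le_left (norm_nonneg _) (hc1 ν)
  -- The polynomial bound at the nodes makes the series absolutely convergent there, so the
  -- consistency hypothesis `hval` identifies its sum.
  have hnode : ∀ j : NodeIndex Λ, HasSum
      (fun ν => hermiteMulti ν (nodePoint x hΓ j) • hermiteCoeff F ν) (f (nodePoint x hΓ j)) := by
    intro j
    obtain ⟨C, hC⟩ := exists_abs_hermiteMulti_node_le hx hK hdetail (nodePoint_mem x hΓ j)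
    have hs : Summable fun ν => hermiteMulti ν (nodePoint x hΓ j) • hermiteCoeff F ν := by
      refine Summable.of_norm_bounded (hsum.mul_left |C|) fun ν => ?_
      rw [norm_smul, Real.norm_eq_abs, ← mul_assoc]
      refine mul_le_mul_of_nonneg_right ((hC ν).trans ?_) (norm_nonneg _)
      exact mul_le_mul (le_abs_self C) (hcθ ν) (Finset.prod_nonneg fun m _ =>
        Real.rpow_nonneg (zero_le_one.trans (hone _)) _) (abs_nonneg _)
    have h := hval _ _ (nodePoint_mem x hΓ j) _ hs.hasSum
    rw [h]
    exact hs.hasSum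
  -- Subtracting the `L²` expansion of `F` and the finitely many nodal expansions expresses the
  -- error as a series of the errors on single Hermite terms.
  have hmain : HasSum (fun ν => smulLp _ (memLp_hermiteMulti_sub_sparseCollocation hΓ Λ ν)
      (hermiteCoeff F ν)) (hF2.toLp F - (memLp_sparseCollocation hΓ Λ f).toLp _) := by
    rw [toLp_sparseCollocation]
    simp only [← hermiteLp_sub_sum_eq]
    exact (hasSum_hermiteLp hF2 hcoef).sub (hasSum_sum fun j _ =>
      (hnode j).mapL (smulLp (nodeWeight x j) (memLp_nodeWeight x j)))
  have hzero : ∀ ν ∈ Λ, smulLp _ (memLp_hermiteMulti_sub_sparseCollocation hΓ Λ ν)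
      (hermiteCoeff F ν) = 0 := by
    intro ν hν
    rw [← norm_eq_zero, norm_smulLp]
    simp only [hermiteMulti_sub_sparseCollocation_eq_zero hΓ hx hΛ hν]
    simp
  have hle : ‖hF2.toLp F - (memLp_sparseCollocation hΓ Λ f).toLp _‖ ≤ B := by
    refine le_of_tendsto hmain.norm (Filter.Eventually.of_forall fun S => ?_)
    rw [← Finset.sum_sdiff (Finset.inter_subset_left : S ∩ Λ ⊆ S),
      Finset.sum_eq_zero fun ν hν => hzero ν (Finset.mem_inter.1 hν).2, add_zero]
    refine (norm_sum_le _ _).trans (le_trans (Finset.sum_le_sum fun ν _ => ?_)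
      (hB (S \ (S ∩ Λ)) ?_))
    · rw [norm_smulLp]
      exact mul_le_mul_of_nonneg_right
        (eLpNorm_hermiteMulti_sub_sparseCollocation_le hΓ hx hK hdetail Λ ν) (norm_nonneg _)
    · rw [Finset.sdiff_inter_self_left]
      exact Finset.sdiff_disjoint
  rw [← MemLp.toLp_sub, Lp.norm_toLp] at hle
  exact (ENNReal.le_ofReal_iff_toReal_le (hF2.sub (memLp_sparseCollocation hΓ Λ f)).2.ne
    (ENNReal.toReal_nonneg.trans hle)).2 hle

end

end SparseCollocation

end

/-! ### Convergence rate of sparse collocation -/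

theorem mainTheorem1 {H : Type*} [NormedAddCommGroup H] [InnerProductSpace ℝ H] [CompleteSpace H]
    [TopologicalSpace.SeparableSpace H]
    -- univariate nodes, pairwise distinct on each level
    (x : ℕ → ℕ → ℝ) (hx : ∀ k, Set.InjOn (x k) (Set.Iic k))
    -- the bound on the univariate details
    (θ K : ℝ) (hθ : 0 ≤ θ) (hK : 1 ≤ K)
    (hdetail : ∀ i ν : ℕ,
      eLpNorm (SparseCollocation.detail x i (SparseCollocation.hermiteFun ν)) 2 (gaussianReal 0 1)
        ≤ ENNReal.ofReal ((1 + K * ν) ^ θ))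
    -- the domain, which contains the nodes
    (Γ : Set (ℕ → ℝ)) (hΓ1 : SparseCollocation.gaussMeasure Γ = 1)
    (hΓ : ∀ k, SparseCollocation.nodeGrid x k ⊆ Γ)
    -- the function and its square integrable extension
    (f : Γ → H) (F : (ℕ → ℝ) → H) (hF : ∀ ξ : Γ, F ξ = f ξ)
    (hF2 : MemLp F 2 SparseCollocation.gaussMeasure)
    -- where the Hermite expansion converges at a node, it gives the value of the function there
    (hval : ∀ (k : ℕ →₀ ℕ) (ξ : Γ), (ξ : ℕ → ℝ) ∈ SparseCollocation.nodeGrid x k →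
      ∀ s : H, HasSum (fun ν : ℕ →₀ ℕ =>
        SparseCollocation.hermiteMulti ν ξ • SparseCollocation.hermiteCoeff F ν) s → f ξ = s)
    -- weighted smoothness
    (p : ℝ) (hp0 : 0 < p) (hp2 : p < 2) (r : ℕ) (hr : 2 * (θ + 1) + 2 / p < r)
    (hsmooth : SparseCollocation.WeightedSmooth p r F) :
    ∃ Λ : ℕ → Finset (ℕ →₀ ℕ),
      (∀ M N, M ≤ N → Λ M ⊆ Λ N) ∧
      (∀ N, IsLowerSet (Λ N : Set (ℕ →₀ ℕ))) ∧
      (∀ N, (Λ N).card = N) ∧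
      ∃ C : ℝ, ∀ N : ℕ,
        eLpNorm (fun ξ => F ξ - SparseCollocation.sparseCollocation x hΓ (Λ N) f ξ) 2
            SparseCollocation.gaussMeasure
          ≤ ENNReal.ofReal (C * (1 + (N : ℝ)) ^ (-(1 / p - 1 / 2))) := by
  open SparseCollocation in
  obtain ⟨τ, hτ, hτp, D, h0, h2, hD, hDsum⟩ := hsmooth
  have hr1 : 1 ≤ r := by
    have : (0 : ℝ) < r := lt_trans (by positivity) hr
    exact_mod_cast this
  obtain ⟨g, A, hA, hg0, hganti, hgp, hgc⟩ := exists_decay_majorant hK hθ hp0 hr hτ hτp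
  obtain ⟨Λ, hnest, hlow, hcard, C, hC, hCN⟩ := exists_nested_sets hp0 hp2 hg0 hganti hgp
  have hw := summable_hermiteWeight_mul hr1 hτ h0 h2 hD hDsum
  set E := ∑' ν, hermiteWeight τ r ν * ‖hermiteCoeff F ν‖ ^ 2 with hE
  have hw0 : ∀ ν, 0 ≤ hermiteWeight τ r ν := fun ν => Finset.prod_nonneg fun m _ =>
    mul_nonneg (Nat.cast_nonneg _) (pow_nonneg (hτ m).le _)
  -- Cauchy–Schwarz between `g` and `√b ‖f_ν‖`; the square root halves the exponent `2/p - 1` of the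
  -- squared tail.
  have key : ∀ (N : ℕ) (S : Finset (ℕ →₀ ℕ)), Disjoint S (Λ N) →
      ∑ ν ∈ S, (ν.prod fun _ n => (1 + K * n) ^ (θ + 1)) * ‖hermiteCoeff F ν‖ ≤
        A * √C * √E * (1 + (N : ℝ)) ^ (-(1 / p - 1 / 2)) := by
    intro N S hS
    have hN : (0 : ℝ) < 1 + N := by positivity
    have h1 : √(∑ ν ∈ S, g ν ^ 2) ≤ √C * (1 + (N : ℝ)) ^ (-(1 / p - 1 / 2)) := by
      refine (Real.sqrt_le_sqrt (hCN N S hS)).trans (le_of_eq ?_)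
      rw [Real.sqrt_mul hC, Real.sqrt_eq_rpow ((1 + (N : ℝ)) ^ _), ← Real.rpow_mul hN.le]
      congr 2
      ring
    have h3 : √(∑ ν ∈ S, (√(hermiteWeight τ r ν) * ‖hermiteCoeff F ν‖) ^ 2) ≤ √E := by
      refine Real.sqrt_le_sqrt ?_
      simp only [mul_pow, Real.sq_sqrt (hw0 _)]
      exact hw.sum_le_tsum _ fun ν _ => mul_nonneg (hw0 ν) (sq_nonneg _)
    calc ∑ ν ∈ S, (ν.prod fun _ n => (1 + K * n) ^ (θ + 1)) * ‖hermiteCoeff F ν‖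
        ≤ ∑ ν ∈ S, A * (g ν * (√(hermiteWeight τ r ν) * ‖hermiteCoeff F ν‖)) := by
          refine Finset.sum_le_sum fun ν _ => ?_
          refine (mul_le_mul_of_nonneg_right (hgc ν) (norm_nonneg _)).trans (le_of_eq ?_)
          ring
      _ = A * ∑ ν ∈ S, g ν * (√(hermiteWeight τ r ν) * ‖hermiteCoeff F ν‖) :=
          (Finset.mul_sum _ _ _).symm
      _ ≤ A * (√(∑ ν ∈ S, g ν ^ 2) *
            √(∑ ν ∈ S, (√(hermiteWeight τ r ν) * ‖hermiteCoeff F ν‖) ^ 2)) :=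
          mul_le_mul_of_nonneg_left (Real.sum_mul_le_sqrt_mul_sqrt _ _ _) hA
      _ ≤ A * (√C * (1 + (N : ℝ)) ^ (-(1 / p - 1 / 2)) * √E) := by gcongr
      _ = _ := by ring
  -- Since `Λ 0` is empty, the tail estimate at `N = 0` bounds all finite sums.
  have hsum : Summable fun ν : ℕ →₀ ℕ =>
      (ν.prod fun _ n => (1 + K * n) ^ (θ + 1)) * ‖hermiteCoeff F ν‖ := by
    refine summable_of_sum_le (fun ν => mul_nonneg (Finset.prod_nonneg fun m _ => ?_)
      (norm_nonneg _)) fun S => key 0 S ?_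
    · exact Real.rpow_nonneg (by positivity) _
    · rw [Finset.card_eq_zero.1 (hcard 0)]
      exact Finset.disjoint_empty_right S
  exact ⟨Λ, hnest, hlow, hcard, A * √C * √E, fun N =>
    norm_toLp_sub_toLp_sparseCollocation_le hΓ hx hθ hK hdetail hF2 hval hsum (hlow N) (key N)⟩
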